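/- **Setting.** Let $X$ be a latent variable with values in a measurable space $\mathcal X$ and let $Y=T(X)$, with $T:\mathcal X\to\mathcal Y$ measurable, be the observation. Let $\nu$ be a $\sigma$-finite measure on $\mathcal Y$ and let $\mu=\int \kappa(y,\cdot)\,\nu(dy)$, where $\kappa$ is an s-finite kernel such that each $\kappa(y,\cdot)$ is carried by the fibre $\{T=y\}$. For $\theta\in\Theta\subset\mathbb R^{m}$ let $f(\cdot;\theta)$ be a probability density with respect to $\mu$, let $g(y;\theta)=\int f(x;\theta)\,\kappa(y,dx)$ be the density of $Y$ with respect to $\nu$, and let $$\bar s(y;\theta)=\mathbb E_\theta[S(X)\mid Y=y]=\frac1{g(y;\theta)}\int S(x)f(x;\theta)\,\kappa(y,dx),$$ where $S:\mathcal X\to\mathbb R^d$ is measurable. Let $\pi$ be a probability density with respect to $\nu$ (not necessarily of the form $g(\cdot;\theta)$), let $\mathbb E_\pi$ be expectation when $Y$ has density $\pi$, and put $K(\theta)=\mathrm{KL}(\pi\|g_\theta)=\mathbb E_\pi[\log(\pi(Y)/g(Y;\theta))]$. **Assumption 1 (curved exponential family).** (a) $f(x;\theta)=h(x)\exp\{-\psi(\theta)+\langle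 S(x),\phi(\theta)\rangle\}$ with $h\ge 0$ measurable. (b) $\bar s(y;\theta)$ is well defined for all $(y,\theta)\in\mathcal Y\times\Theta$, that is, $0<g(y;\theta)<\infty$ and $\int|S(x)|f(x;\theta)\,\kappa(y,dx)<\infty$. (c) $\mathcal S\subset\mathbb R^d$ is a convex open set such that $(1-\gamma)s+\gamma\bar s(y;\theta)\in\mathcal S$ for all $s\in\mathcal S$, $(y,\theta)\in\mathcal Y\times\Theta$, $\gamma\in[0,1)$, and such that for every $s\in\mathcal S$ the function $\ell(s;\theta)=-\psi(\theta)+\langle s,\phi(\theta)\rangle$ has a unique global maximiser $\bar\theta(s)$ over $\theta\in\Theta$. **Assumption 2 (regularity).** (a) $\Theta$ is open and convex, and $\psi,\phi$ are $C^2$ on $\Theta$. (b) $\bar\theta$ is $C^1$ on $\mathcal S$. (c) For some $q>2$ and all compact $\mathcal K\subset\mathcal S$, $\sup_{s\in\mathcal K}\mathbb E_\pi|\bar s(Y;\bar\theta(s))|^q<\infty$. (d) For every $y\in\mathcal Y$ the map $\theta\mapsto\bar s(y;\theta)$ is continuous on $\Theta$, and $K$ is finite and differentiable on $\Theta$. Let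 $\mathsf h(s)=\mathbb E_\pi[\bar s(Y;\bar\theta(s))]-s$ be the mean field on $\mathcal S$, $\Gamma=\{s\in\mathcal S:\mathsf h(s)=0\}$, $\mathsf w(s)=K(\bar\theta(s))$ for $s\in\mathcal S$, and $\mathcal L=\{\theta\in\Theta:\nabla K(\theta)=0\}$. Let $Y_1,Y_2,\dots$ be i.i.d. with density $\pi$, let $\hat s_0$ be an $\mathcal S$-valued random vector independent of $(Y_i)_{i\ge1}$ (for instance a constant), and define for $n\ge0$ $$\hat\theta_n=\bar\theta(\hat s_n),\qquad \hat s_{n+1}=\hat s_n+\gamma_{n+1}\bigl(\bar s(Y_{n+1};\hat\theta_n)-\hat s_n\bigr).$$ For a point $x$ and a set $A$ let $d(x,A)=\inf_{y\in A}|x-y|$, with $\inf\emptyset=+\infty$. **Theorem.** Suppose that Assumptions 1 and 2 hold and that 1. $0<\gamma_i<1$ for all $i\ge1$, $\sum_{i\ge1}\gamma_i=\infty$ and $\sum_{i\ge1}\gamma_i^2<\infty$; 2. with probability one, $\limsup_n|\hat s_n|<\infty$ and $\liminf_n d(\hat s_n,\mathcal S^c)>0$; 3. the set $\mathsf w(\Gamma)\subset\mathbb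 R$ is nowhere dense. Then, with probability one, $\lim_{n\to\infty}d(\hat s_n,\Gamma)=0$ and $\lim_{n\to\infty}d(\hat\theta_n,\mathcal L)=0$. -/

import Mathlib

open MeasureTheory ProbabilityTheory Filter Topology

noncomputable section

namespace OnlineEM

/-- The data of a latent variable model whose complete data likelihood is written in (curved)
exponential form.  `base` dominates the law of the latent variable `X`, `ref` dominates the law of
the observation `Y = obs X`, and `fiber y` is the measure carried by the fibre `{x | obs x = y}`
along which the complete data density is integrated to obtain the density of `Y`. -/
structure LatentModel (𝒳 𝒴 : Type*) [MeasurableSpace 𝒳] [MeasurableSpace 𝒴] (d m : ℕ) where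
  /-- the dominating measure on the complete data space -/
  base : Measure 𝒳
  /-- the dominating measure on the observation space -/
  ref : Measure 𝒴
  /-- the observation as a deterministic function of the latent variable -/
  obs : 𝒳 → 𝒴
  /-- the disintegration of `base` along `obs` with respect to `ref` -/
  fiber : Kernel 𝒴 𝒳
  /-- the carrier function `h` -/
  h : 𝒳 → ℝ
  /-- the complete data sufficient statistic `S` -/
  S : 𝒳 → EuclideanSpace ℝ (Fin d)
  /-- the parameter set -/
  Θ : Set (EuclideanSpace ℝ (Fin m))
  /-- the log-normaliser `ψ` -/
  ψ : EuclideanSpace ℝ (Fin m) → ℝ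
  /-- the parametrisation `φ` of the natural parameter -/
  φ : EuclideanSpace ℝ (Fin m) → EuclideanSpace ℝ (Fin d)

namespace LatentModel

variable {𝒳 𝒴 : Type*} [MeasurableSpace 𝒳] [MeasurableSpace 𝒴] {d m : ℕ}

/-- The complete data likelihood `f(x; θ) = h(x) exp(-ψ(θ) + ⟨S(x), φ(θ)⟩)`. -/
def f (M : LatentModel 𝒳 𝒴 d m) (x : 𝒳) (θ : EuclideanSpace ℝ (Fin m)) : ℝ :=
  M.h x * Real.exp (-M.ψ θ + inner ℝ (M.S x) (M.φ θ))

/-- The observed likelihood `g(y; θ)`, the density of `Y = obs X` with respect to `ref`. -/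
def g (M : LatentModel 𝒳 𝒴 d m) (y : 𝒴) (θ : EuclideanSpace ℝ (Fin m)) : ℝ :=
  ∫ x, M.f x θ ∂(M.fiber y)

/-- The conditional expectation `s̄(y; θ) = E_θ[S(X) | Y = y]`: the integral of `S` against the
conditional law of `X` given `Y = y`, which has density `f(x; θ) / g(y; θ)` on the fibre. -/
def condStat (M : LatentModel 𝒳 𝒴 d m) (y : 𝒴) (θ : EuclideanSpace ℝ (Fin m)) :
    EuclideanSpace ℝ (Fin d) :=
  (M.g y θ)⁻¹ • ∫ x, M.f x θ • M.S x ∂(M.fiber y)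

/-- The function `ℓ(s; θ) = -ψ(θ) + ⟨s, φ(θ)⟩`. -/
def ell (M : LatentModel 𝒳 𝒴 d m) (s : EuclideanSpace ℝ (Fin d))
    (θ : EuclideanSpace ℝ (Fin m)) : ℝ :=
  -M.ψ θ + inner ℝ s (M.φ θ)

/-- `θ̄(s)`, a maximiser of `ℓ(s; ·)` over `Θ` (arbitrary if there is none). -/
def thetaBar (M : LatentModel 𝒳 𝒴 d m) (s : EuclideanSpace ℝ (Fin d)) :
    EuclideanSpace ℝ (Fin m) :=
  Classical.epsilon fun θ => θ ∈ M.Θ ∧ IsMaxOn (M.ell s) M.Θ θ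

/-- `M` is a parametric family of probability densities for the latent variable `X`, with an
observation `Y = obs X`. -/
structure IsLatentFamily (M : LatentModel 𝒳 𝒴 d m) : Prop where
  sigmaFinite_ref : SigmaFinite M.ref
  isSFiniteKernel_fiber : IsSFiniteKernel M.fiber
  measurable_obs : Measurable M.obs
  base_eq : M.base = M.ref.bind M.fiber
  obs_fiber : ∀ y, ∀ᵐ x ∂(M.fiber y), M.obs x = y
  measurable_h : Measurable M.h
  h_nonneg : ∀ x, 0 ≤ M.h x
  measurable_S : Measurable M.S
  lintegral_f : ∀ θ ∈ M.Θ, ∫⁻ x, ENNReal.ofReal (M.f x θ) ∂M.base = 1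

/-- The structural assumption on the curved exponential family, relative to the set `𝒮`. -/
structure ExponentialAssumption (M : LatentModel 𝒳 𝒴 d m)
    (𝒮 : Set (EuclideanSpace ℝ (Fin d))) : Prop where
  /-- `E_θ[S(X) | Y = y]` is well defined for all `y` and all `θ ∈ Θ` -/
  condStat_wellDefined : ∀ y, ∀ θ ∈ M.Θ, 0 < M.g y θ ∧
    Integrable (fun x => M.f x θ) (M.fiber y) ∧ Integrable (fun x => M.f x θ • M.S x) (M.fiber y)
  isOpen : IsOpen 𝒮
  convex : Convex ℝ 𝒮
  stable : ∀ s ∈ 𝒮, ∀ y, ∀ θ ∈ M.Θ, ∀ γ : ℝ, 0 ≤ γ → γ < 1 →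
    (1 - γ) • s + γ • M.condStat y θ ∈ 𝒮
  existsUnique_max : ∀ s ∈ 𝒮, ∃! θ, θ ∈ M.Θ ∧ IsMaxOn (M.ell s) M.Θ θ

/-- The law of an observation with density `p` with respect to `ref`. -/
def obsLaw (M : LatentModel 𝒳 𝒴 d m) (p : 𝒴 → ℝ) : Measure 𝒴 :=
  M.ref.withDensity fun y => ENNReal.ofReal (p y)

/-- `p` is a probability density function on the observation space. -/
structure IsObsDensity (M : LatentModel 𝒳 𝒴 d m) (p : 𝒴 → ℝ) : Prop where
  measurable : Measurable p
  nonneg : ∀ y, 0 ≤ p y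
  lintegral_eq_one : ∫⁻ y, ENNReal.ofReal (p y) ∂M.ref = 1

/-- The Kullback-Leibler divergence `KL(p ‖ g_θ) = E_p[log (p(Y) / g(Y; θ))]`, when it is
finite. -/
def kl (M : LatentModel 𝒳 𝒴 d m) (p : 𝒴 → ℝ) (θ : EuclideanSpace ℝ (Fin m)) : ℝ :=
  ∫ y, Real.log (p y / M.g y θ) ∂(M.obsLaw p)

/-- The regularity assumptions. The field `moment` is
`sup_{s ∈ K} E_p |s̄(Y; θ̄(s))|^q < ∞` for some `q > 2` and all compact `K ⊆ 𝒮`. -/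
structure RegularityAssumption (M : LatentModel 𝒳 𝒴 d m)
    (𝒮 : Set (EuclideanSpace ℝ (Fin d))) (p : 𝒴 → ℝ) : Prop where
  isOpen : IsOpen M.Θ
  convex : Convex ℝ M.Θ
  contDiffOn_ψ : ContDiffOn ℝ 2 M.ψ M.Θ
  contDiffOn_φ : ContDiffOn ℝ 2 M.φ M.Θ
  contDiffOn_thetaBar : ContDiffOn ℝ 1 M.thetaBar 𝒮
  moment : ∃ q : ℝ, 2 < q ∧ ∀ K ⊆ 𝒮, IsCompact K →
    ⨆ s ∈ K, ∫⁻ y, ‖M.condStat y (M.thetaBar s)‖ₑ ^ q ∂(M.obsLaw p) < ⊤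

/-- The smoothness of the observed model which is understood when the gradient of
`θ ↦ KL(p ‖ g_θ)` and the mean field are used: the E-step is continuous in the parameter, and the
Kullback-Leibler divergence is a finite, differentiable function on `Θ`. -/
structure ObservedRegularity (M : LatentModel 𝒳 𝒴 d m) (p : 𝒴 → ℝ) : Prop where
  continuousOn_condStat : ∀ y, ContinuousOn (fun θ => M.condStat y θ) M.Θ
  integrable_kl : ∀ θ ∈ M.Θ, Integrable (fun y => Real.log (p y / M.g y θ)) (M.obsLaw p)
  differentiableOn_kl : DifferentiableOn ℝ (M.kl p) M.Θ

/-- The mean field `E_p[s̄(Y; θ̄(s))] - s`. -/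
def meanField (M : LatentModel 𝒳 𝒴 d m) (p : 𝒴 → ℝ) (s : EuclideanSpace ℝ (Fin d)) :
    EuclideanSpace ℝ (Fin d) :=
  ∫ y, M.condStat y (M.thetaBar s) ∂(M.obsLaw p) - s

/-- The set `Γ` of roots of the mean field in `𝒮`. -/
def roots (M : LatentModel 𝒳 𝒴 d m) (𝒮 : Set (EuclideanSpace ℝ (Fin d))) (p : 𝒴 → ℝ) :
    Set (EuclideanSpace ℝ (Fin d)) :=
  {s ∈ 𝒮 | M.meanField p s = 0}

/-- The function `w(s) = KL(p ‖ g_{θ̄(s)})`. -/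
def lyapunov (M : LatentModel 𝒳 𝒴 d m) (p : 𝒴 → ℝ) (s : EuclideanSpace ℝ (Fin d)) : ℝ :=
  M.kl p (M.thetaBar s)

/-- The set `L` of stationary points in `Θ` of `θ ↦ KL(p ‖ g_θ)`. -/
def stationaryPoints (M : LatentModel 𝒳 𝒴 d m) (p : 𝒴 → ℝ) :
    Set (EuclideanSpace ℝ (Fin m)) :=
  {θ ∈ M.Θ | HasGradientAt (M.kl p) 0 θ}

/-- The online EM recursion on sufficient statistics started at `s₀`, with step sizes
`γ 1, γ 2, …` and observations `y 1, y 2, …` (`γ 0` and `y 0` are not used). -/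
def stat (M : LatentModel 𝒳 𝒴 d m) (γ : ℕ → ℝ) (y : ℕ → 𝒴) (s₀ : EuclideanSpace ℝ (Fin d)) :
    ℕ → EuclideanSpace ℝ (Fin d)
  | 0 => s₀
  | n + 1 => M.stat γ y s₀ n +
      γ (n + 1) • (M.condStat (y (n + 1)) (M.thetaBar (M.stat γ y s₀ n)) - M.stat γ y s₀ n)

/-- The online EM parameter estimate `θ̂_n = θ̄(ŝ_n)`. -/
def param (M : LatentModel 𝒳 𝒴 d m) (γ : ℕ → ℝ) (y : ℕ → 𝒴) (s₀ : EuclideanSpace ℝ (Fin d))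
    (n : ℕ) : EuclideanSpace ℝ (Fin m) :=
  M.thetaBar (M.stat γ y s₀ n)

end LatentModel

end OnlineEM

end

/-! Write h for the mean field, η = φ ∘ θ̄ and w = K ∘ θ̄. The function V(s) = max_θ ℓ(s; θ) is a
supremum of functions affine in s, and η(s) is a subgradient of V at s. As η is C¹, it is the
gradient of V, so Dη is a Hessian, symmetric and positive semidefinite. The EM inequality bounds K
above by an explicit smooth function that touches it at θ̄(s); equating derivatives gives ∇w = -Dη
h, so w decreases along h at rate ⟨h, Dη h⟩.

Dη may be degenerate, so this rate may vanish off Γ. Semidefiniteness then gives Dη h = 0: η is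
stationary along h. Members of the family with equal φ(θ) have the same density, so the target s +
h(s) = E_π[s̄(Y; θ̄(s))] depends on s only through η(s). Hence, as long as w hardly decreases, the
target is nearly frozen and the recursion contracts to it exponentially. Over a window of fixed
length, either w drops by a fixed ε or |h| ends below δ (`exists_decrease_of_le_norm`). Since w(Γ)
is nowhere dense, this forbids infinitely many upcrossings of any interval, so w converges
(`tendsto_of_forall_exists_decrease`); after that no drop by ε is possible and h → 0
(`tendsto_zero_of_forall_exists_decrease`).

The noise, cut off outside a compact set, has martingale partial sums bounded in L². Adding the tail
of the convergent noise series to the statistics leaves a recursion with vanishing perturbation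
(`tendsto_meanField_of_noise`). Compactness turns h → 0 into convergence of the distances, since K
is stationary at θ̄(s) when h(s) = 0. -/

open scoped RealInnerProductSpace ENNReal

namespace OnlineEM

/-! ### Compactness estimates and single steps of a Robbins-Monro recursion. -/

section Deterministic

/-- On the part of the compact image of `(f, g)` where the second coordinate is at least `ε`, the
first attains a minimum, positive because `f x = 0` forces `g x = 0`. -/
theorem exists_pos_forall_lt_of_isCompact {X : Type*} [TopologicalSpace X] {K : Set X}
    (hK : IsCompact K) {f g : X → ℝ} (hf : ContinuousOn f K) (hg : ContinuousOn g K)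
    (hf0 : ∀ x ∈ K, 0 ≤ f x) (hfg : ∀ x ∈ K, f x = 0 → g x = 0) {ε : ℝ} (hε : 0 < ε) :
    ∃ δ > 0, ∀ x ∈ K, f x < δ → g x < ε := by
  by_contra! hcon
  have hcpt : IsCompact ((fun x => (f x, g x)) '' K) :=
    hK.image_of_continuousOn (hf.prodMk hg)
  have hcl : IsCompact (((fun x => (f x, g x)) '' K) ∩ (Prod.snd ⁻¹' Set.Ici ε)) :=
    hcpt.inter_right (isClosed_Ici.preimage continuous_snd)
  have hne' : (((fun x => (f x, g x)) '' K) ∩ (Prod.snd ⁻¹' Set.Ici ε)).Nonempty := by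
    obtain ⟨x, hx, -, hxε⟩ := hcon 1 one_pos
    exact ⟨_, ⟨x, hx, rfl⟩, hxε⟩
  obtain ⟨z, ⟨⟨x, hx, rfl⟩, hxε⟩, hmin⟩ :=
    hcl.exists_isMinOn hne' continuous_fst.continuousOn
  have hpos : 0 < f x := lt_of_le_of_ne (hf0 x hx) fun h0 => by
    have := hfg x hx h0.symm
    simp only [Set.mem_preimage, Set.mem_Ici] at hxε
    linarith
  obtain ⟨y, hy, hlt, hge⟩ := hcon (f x) hpos
  have := hmin (⟨⟨y, hy, rfl⟩, hge⟩ :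
    (f y, g y) ∈ ((fun x => (f x, g x)) '' K) ∩ (Prod.snd ⁻¹' Set.Ici ε))
  simp only [Set.mem_ofPred_eq] at this
  linarith

/-- Where `a` is small `b` is at most `κ`; elsewhere `a` is bounded below and a multiple of it
exceeds `max b`. This later bounds the speed of η by the dissipation of w. -/
theorem exists_forall_le_add_mul_of_isCompact {X : Type*} [TopologicalSpace X] {K : Set X}
    (hK : IsCompact K) {a b : X → ℝ} (ha : ContinuousOn a K) (hb : ContinuousOn b K)
    (ha0 : ∀ x ∈ K, 0 ≤ a x) (hab : ∀ x ∈ K, a x = 0 → b x = 0) {κ : ℝ} (hκ : 0 < κ) :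
    ∃ C > 0, ∀ x ∈ K, b x ≤ κ + C * a x := by
  obtain ⟨δ, hδ, h⟩ := exists_pos_forall_lt_of_isCompact hK ha hb ha0 hab hκ
  obtain ⟨B, hB⟩ := (hK.image_of_continuousOn hb).bddAbove
  refine ⟨max B 1 / δ, by positivity, fun x hx => ?_⟩
  have hBx : b x ≤ B := hB ⟨x, hx, rfl⟩
  rcases lt_or_ge (a x) δ with hlt | hge
  · have := h x hx hlt
    have : 0 ≤ max B 1 / δ * a x := mul_nonneg (by positivity) (ha0 x hx)
    linarith
  · have h1 : max B 1 / δ * δ ≤ max B 1 / δ * a x :=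
      mul_le_mul_of_nonneg_left hge (by positivity)
    rw [div_mul_cancel₀ _ hδ.ne'] at h1
    linarith [le_max_left B 1]

variable {E F : Type*} [NormedAddCommGroup E] [NormedSpace ℝ E]
  [NormedAddCommGroup F] [NormedSpace ℝ F]

/-- The radius is a Lebesgue number of a cover of `K` by balls on which `f'` is within `ε / 2` of
its value at the centre; the mean value inequality does the rest. -/
theorem exists_pos_forall_norm_sub_sub_le {U K : Set E} (hU : IsOpen U) (hK : IsCompact K)
    (hKU : K ⊆ U) {f : E → F} {f' : E → E →L[ℝ] F} (hf : ∀ x ∈ U, HasFDerivAt f (f' x) x)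
    (hf' : ContinuousOn f' U) {ε : ℝ} (hε : 0 < ε) :
    ∃ δ > 0, ∀ x ∈ K, ∀ y, ‖y - x‖ < δ → ‖f y - f x - f' x (y - x)‖ ≤ ε * ‖y - x‖ := by
  have hloc : ∀ x : K, ∃ r > 0, Metric.ball (x : E) r ⊆ U ∧
      ∀ z ∈ Metric.ball (x : E) r, ‖f' z - f' x‖ < ε / 2 := by
    intro x
    have hxU := hU.mem_nhds (hKU x.2)
    have h1 : ∀ᶠ z in 𝓝 (x : E), ‖f' z - f' x‖ < ε / 2 := by
      have := (Metric.tendsto_nhds.1 (hf'.continuousAt hxU)) (ε / 2) (half_pos hε)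
      simpa only [dist_eq_norm] using this
    obtain ⟨r, hr, hsub⟩ := Metric.eventually_nhds_iff_ball.1 (hxU |> Filter.Eventually.and h1)
    exact ⟨r, hr, fun z hz => (hsub z hz).2, fun z hz => (hsub z hz).1⟩
  choose r hr hrU hrf using hloc
  obtain ⟨δ, hδ, hcov⟩ := lebesgue_number_lemma_of_metric hK
    (c := fun x : K => Metric.ball (x : E) (r x)) (fun _ => Metric.isOpen_ball)
    (fun x hx => Set.mem_iUnion.2 ⟨⟨x, hx⟩, Metric.mem_ball_self (hr _)⟩)
  refine ⟨δ, hδ, fun x hx y hy => ?_⟩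
  obtain ⟨i, hi⟩ := hcov x hx
  refine (convex_ball x δ).norm_image_sub_le_of_norm_hasFDerivWithin_le' (f' := f')
    (fun z hz => (hf z (hrU i (hi hz))).hasFDerivWithinAt) (fun z hz => ?_)
    (Metric.mem_ball_self hδ) (by rwa [Metric.mem_ball, dist_eq_norm])
  have h1 := hrf i z (hi hz)
  have h2 := hrf i x (hi (Metric.mem_ball_self hδ))
  calc ‖f' z - f' x‖ = ‖(f' z - f' i) - (f' x - f' i)‖ := by congr 1; abel
    _ ≤ ‖f' z - f' i‖ + ‖f' x - f' i‖ := norm_sub_le _ _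
    _ ≤ ε := by linarith

/-- First order expansion along a Robbins-Monro sequence staying in a compact set. -/
theorem eventually_norm_sub_sub_smul_le {U K : Set E} (hU : IsOpen U) (hK : IsCompact K)
    (hKU : K ⊆ U) {f : E → F} {f' : E → E →L[ℝ] F} (hf : ∀ x ∈ U, HasFDerivAt f (f' x) x)
    (hf' : ContinuousOn f' U) {h : E → E} (hh : ContinuousOn h U) {γ : ℕ → ℝ}
    (hγ : ∀ n, 0 < γ n) (hγ0 : Tendsto γ atTop (𝓝 0)) {x e : ℕ → E} (hx : ∀ n, x n ∈ K)
    (he : Tendsto e atTop (𝓝 0)) (hrec : ∀ n, x (n + 1) = x n + γ n • (h (x n) + e n))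
    {ε : ℝ} (hε : 0 < ε) :
    ∀ᶠ n in atTop, ‖f (x (n + 1)) - f (x n) - γ n • f' (x n) (h (x n))‖ ≤ γ n * ε := by
  obtain ⟨B, hB⟩ := hK.exists_bound_of_continuousOn (hh.mono hKU)
  obtain ⟨C, hC⟩ := hK.exists_bound_of_continuousOn (hf'.mono hKU)
  have hB0 : 0 ≤ B := (norm_nonneg _).trans (hB _ (hx 0))
  have hC0 : 0 ≤ C := (norm_nonneg _).trans (hC _ (hx 0))
  -- Once `‖e n‖ ≤ 1`, a step has length at most `γ n * (B + 1)`. Half of `ε` pays for the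
  -- remainder, half for `f' (x n) (e n)`.
  obtain ⟨δ, hδ, hdiff⟩ := exists_pos_forall_norm_sub_sub_le hU hK hKU hf hf'
    (ε := ε / (2 * (B + 1))) (by positivity)
  have he' : ∀ᶠ n in atTop, ‖e n‖ < min 1 (ε / (2 * (C + 1))) := by
    have := he.norm
    rw [norm_zero] at this
    exact this.eventually (gt_mem_nhds (by positivity))
  have hγ' : ∀ᶠ n in atTop, γ n < δ / (B + 1) :=
    hγ0.eventually (gt_mem_nhds (by positivity))
  filter_upwards [he', hγ'] with n hen hγn
  have hv : x (n + 1) - x n = γ n • (h (x n) + e n) := by rw [hrec]; abel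
  have hvn : ‖x (n + 1) - x n‖ ≤ γ n * (B + 1) := by
    rw [hv, norm_smul, Real.norm_of_nonneg (hγ n).le]
    refine mul_le_mul_of_nonneg_left ((norm_add_le _ _).trans ?_) (hγ n).le
    exact add_le_add (hB _ (hx n)) (hen.le.trans (min_le_left _ _))
  have hlt : ‖x (n + 1) - x n‖ < δ := hvn.trans_lt (by rwa [← lt_div_iff₀ (by positivity)])
  have h1 := hdiff (x n) (hx n) (x (n + 1)) hlt
  have h2 : ‖f' (x n) (e n)‖ ≤ ε / 2 := by
    have h3 := (f' (x n)).le_opNorm (e n)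
    have h4 : ‖e n‖ ≤ ε / (2 * (C + 1)) := hen.le.trans (min_le_right _ _)
    calc _ ≤ ‖f' (x n)‖ * ‖e n‖ := h3
      _ ≤ (C + 1) * (ε / (2 * (C + 1))) :=
        mul_le_mul ((hC _ (hx n)).trans (by linarith)) h4 (norm_nonneg _) (by positivity)
      _ = ε / 2 := by field_simp
  have heq : f (x (n + 1)) - f (x n) - γ n • f' (x n) (h (x n)) =
      (f (x (n + 1)) - f (x n) - f' (x n) (x (n + 1) - x n)) + γ n • f' (x n) (e n) := by
    rw [hv, map_smul, map_add, smul_add]; abel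
  rw [heq]
  calc _ ≤ ‖f (x (n + 1)) - f (x n) - f' (x n) (x (n + 1) - x n)‖ + ‖γ n • f' (x n) (e n)‖ :=
        norm_add_le _ _
    _ ≤ ε / (2 * (B + 1)) * (γ n * (B + 1)) + γ n * (ε / 2) := by
        refine add_le_add (h1.trans (mul_le_mul_of_nonneg_left hvn (by positivity))) ?_
        rw [norm_smul, Real.norm_of_nonneg (hγ n).le]
        exact mul_le_mul_of_nonneg_left h2 (hγ n).le
    _ = γ n * ε := by field_simp; ring

/-- Averaging towards targets which are close to `c` contracts exponentially fast to a
neighbourhood of `c`. -/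
theorem norm_sub_le_exp_mul_add {γ : ℕ → ℝ} (hγ : ∀ n, 0 < γ n ∧ γ n < 1) {x u : ℕ → E} {c : E}
    (hrec : ∀ n, x (n + 1) = x n + γ n • (u n - x n)) {ρ : ℝ} (hρ : 0 ≤ ρ) {m n : ℕ} (hmn : m ≤ n)
    (hu : ∀ k, m ≤ k → k < n → ‖u k - c‖ ≤ ρ) :
    ‖x n - c‖ ≤ Real.exp (-∑ k ∈ Finset.Ico m n, γ k) * ‖x m - c‖ + ρ := by
  induction n, hmn using Nat.le_induction with
  | base => simpa using hρ
  | succ n hmn ih =>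
    have ih := ih fun k hk hkn => hu k hk (hkn.trans n.lt_succ_self)
    have hun := hu n hmn n.lt_succ_self
    have hγn := hγ n
    rw [Finset.sum_Ico_succ_top hmn, neg_add, Real.exp_add]
    -- In this convex combination the level `ρ` reproduces itself, and the factor `1 - γ n ≤ exp (-γ
    -- n)` acts on the initial gap alone.
    have heq : x (n + 1) - c = (1 - γ n) • (x n - c) + γ n • (u n - c) := by
      rw [hrec]; module
    have hexp : 1 - γ n ≤ Real.exp (-γ n) := by linarith [Real.add_one_le_exp (-γ n)]
    have hD : 0 ≤ Real.exp (-∑ k ∈ Finset.Ico m n, γ k) * ‖x m - c‖ := by positivity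
    rw [heq]
    calc _ ≤ (1 - γ n) * ‖x n - c‖ + γ n * ‖u n - c‖ := by
          refine (norm_add_le _ _).trans (le_of_eq ?_)
          rw [norm_smul, norm_smul, Real.norm_of_nonneg hγn.1.le,
            Real.norm_of_nonneg (by linarith : 0 ≤ 1 - γ n)]
      _ ≤ (1 - γ n) * (Real.exp (-∑ k ∈ Finset.Ico m n, γ k) * ‖x m - c‖ + ρ) + γ n * ρ :=
          add_le_add (mul_le_mul_of_nonneg_left ih (by linarith))
            (mul_le_mul_of_nonneg_left hun hγn.1.le)
      _ = (1 - γ n) * (Real.exp (-∑ k ∈ Finset.Ico m n, γ k) * ‖x m - c‖) + ρ := by ring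
      _ ≤ Real.exp (-γ n) * (Real.exp (-∑ k ∈ Finset.Ico m n, γ k) * ‖x m - c‖) + ρ := by
          gcongr
      _ = _ := by ring

end Deterministic

/-! ### The Lyapunov argument for a degenerate Lyapunov function. -/

section Recursion

variable {E F : Type*} [NormedAddCommGroup E] [NormedSpace ℝ E] [NormedAddCommGroup F]

/-- Dropping the first term costs less than 1, so a sum above `T + 1` stays above `T`; terms are
dropped until the sum is at most `T + 1`. -/
theorem exists_window {γ : ℕ → ℝ} (hγ : ∀ n, 0 < γ n ∧ γ n < 1) {T : ℝ} (hT : 0 < T) {m n : ℕ}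
    (hmn : m ≤ n) (ht : T ≤ ∑ k ∈ Finset.Ico m n, γ k) :
    ∃ m', m ≤ m' ∧ m' < n ∧ T ≤ ∑ k ∈ Finset.Ico m' n, γ k ∧
      ∑ k ∈ Finset.Ico m' n, γ k ≤ T + 1 := by
  have hlt : ∀ j, T ≤ ∑ k ∈ Finset.Ico j n, γ k → j < n := fun j hj => by
    by_contra! hle
    rw [Finset.Ico_eq_empty_of_le hle, Finset.sum_empty] at hj
    linarith
  induction hmn using Nat.decreasingInduction with
  | self => exact absurd (hlt n ht) (lt_irrefl n)
  | of_succ j hj ih =>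
    by_cases hle : ∑ k ∈ Finset.Ico j n, γ k ≤ T + 1
    · exact ⟨j, le_rfl, hlt j ht, ht, hle⟩
    · push Not at hle
      rw [Finset.sum_eq_sum_Ico_succ_bot hj] at hle
      obtain ⟨m', h1, h2⟩ := ih (by linarith [(hγ j).2])
      exact ⟨m', by omega, h2⟩

theorem le_sub_sum_add_mul {W A γ : ℕ → ℝ} {ε : ℝ} {m n : ℕ} (hmn : m ≤ n)
    (hW : ∀ k, m ≤ k → W (k + 1) ≤ W k - γ k * A k + γ k * ε) :
    W n ≤ W m - ∑ k ∈ Finset.Ico m n, γ k * A k + ε * ∑ k ∈ Finset.Ico m n, γ k := by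
  induction n, hmn using Nat.le_induction with
  | base => simp
  | succ n hmn ih =>
    rw [Finset.sum_Ico_succ_top hmn, Finset.sum_Ico_succ_top hmn]
    linarith [hW n hmn]

/-- If the target `G n` of the recursion is still far from `x n`, then the Lyapunov function has
decreased by a fixed amount over the last stretch of a fixed length. -/
theorem exists_decrease_of_le_norm {γ : ℕ → ℝ} (hγ : ∀ n, 0 < γ n ∧ γ n < 1)
    {x G e : ℕ → E} {η : ℕ → F} {W A b : ℕ → ℝ} {D : ℝ}
    (hrec : ∀ n, x (n + 1) = x n + γ n • ((G n + e n) - x n)) (he : Tendsto e atTop (𝓝 0))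
    (hA : ∀ n, 0 ≤ A n) (hD : ∀ m n, ‖x m - G n‖ ≤ D)
    (hW : ∀ ε > 0, ∀ᶠ n in atTop, W (n + 1) ≤ W n - γ n * A n + γ n * ε)
    (hη : ∀ ε > 0, ∀ᶠ n in atTop, ‖η (n + 1) - η n‖ ≤ γ n * (b n + ε))
    (hb : ∀ κ > 0, ∃ C > 0, ∀ n, b n ≤ κ + C * A n)
    (hG : ∀ ε > 0, ∃ δ > 0, ∀ m n, ‖η m - η n‖ < δ → ‖G m - G n‖ < ε)
    {δ : ℝ} (hδ : 0 < δ) :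
    ∃ T > 0, ∃ ε > 0, ∃ N, ∀ m n, N ≤ m → m ≤ n → T ≤ ∑ k ∈ Finset.Ico m n, γ k →
      ∑ k ∈ Finset.Ico m n, γ k ≤ T + 1 → δ ≤ ‖G n - x n‖ → W n ≤ W m - ε := by
  have hD0 : 0 ≤ D := (norm_nonneg _).trans (hD 0 0)
  -- `T` is long enough for the contraction to wipe out any initial gap, which is at most `D`.
  obtain ⟨T, hT, hTD⟩ : ∃ T > 0, Real.exp (-T) * D < δ / 2 := by
    have h1 : Tendsto (fun T => Real.exp (-T) * D) atTop (𝓝 (0 * D)) :=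
      (Real.tendsto_exp_neg_atTop_nhds_zero).mul_const D
    rw [zero_mul] at h1
    exact ((eventually_gt_atTop 0).and (h1.eventually (gt_mem_nhds (half_pos hδ)))).exists
  obtain ⟨δ', hδ', hGδ⟩ := hG (δ / 4) (by positivity)
  obtain ⟨C, hC, hbC⟩ := hb (δ' / (4 * (T + 1))) (by positivity)
  -- With total dissipation at most `2 * ε`, η moves by at most `δ' / 2 + 2 * C * ε = 3 / 4 * δ'`
  -- over the window.
  set ε : ℝ := δ' / (8 * C) with hε
  have hε0 : 0 < ε := by positivity
  have he' : ∀ᶠ n in atTop, ‖e n‖ < δ / 4 := by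
    have := he.norm
    rw [norm_zero] at this
    exact this.eventually (gt_mem_nhds (by positivity))
  obtain ⟨N, hN⟩ := eventually_atTop.1
    (((hW (ε / (T + 1)) (by positivity)).and
      (hη (δ' / (4 * (T + 1))) (by positivity))).and he')
  refine ⟨T, hT, ε, hε0, N, fun m n hm hmn hTt htT hδn => ?_⟩
  by_contra! hlt
  have hT1 : 0 < T + 1 := by linarith
  -- Failure of the drop bounds the dissipation: one `ε` from the assumed `W m - ε < W n`, one from
  -- the accumulated errors.
  have hsumA : ∑ k ∈ Finset.Ico m n, γ k * A k ≤ 2 * ε := by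
    have h1 := le_sub_sum_add_mul hmn fun k hk => (hN k (hm.trans hk)).1.1
    have h2 : ε / (T + 1) * ∑ k ∈ Finset.Ico m n, γ k ≤ ε / (T + 1) * (T + 1) :=
      mul_le_mul_of_nonneg_left htT (by positivity)
    rw [div_mul_cancel₀ _ hT1.ne'] at h2
    linarith
  have hclose : ∀ k, m ≤ k → k < n → ‖η k - η n‖ < δ' := by
    intro k hmk hkn
    have hsub : Finset.Ico k n ⊆ Finset.Ico m n := Finset.Ico_subset_Ico_left hmk
    have hgA : ∑ j ∈ Finset.Ico k n, γ j * A j ≤ 2 * ε :=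
      (Finset.sum_le_sum_of_subset_of_nonneg hsub fun j _ _ =>
        mul_nonneg (hγ j).1.le (hA j)).trans hsumA
    have hg : ∑ j ∈ Finset.Ico k n, γ j ≤ T + 1 :=
      (Finset.sum_le_sum_of_subset_of_nonneg hsub fun j _ _ => (hγ j).1.le).trans htT
    have hstep : ∀ j ∈ Finset.Ico k n,
        dist (η j) (η (j + 1)) ≤ δ' / (2 * (T + 1)) * γ j + C * (γ j * A j) := by
      intro j hj
      have hNj := (hN j ((hm.trans hmk).trans (Finset.mem_Ico.1 hj).1)).1.2
      rw [dist_comm, dist_eq_norm]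
      have h3 := mul_le_mul_of_nonneg_left (hbC j) (hγ j).1.le
      have h4 : γ j * (b j + δ' / (4 * (T + 1))) ≤
          γ j * (δ' / (4 * (T + 1)) + C * A j) + γ j * (δ' / (4 * (T + 1))) := by linarith
      refine hNj.trans (h4.trans (le_of_eq ?_))
      field_simp
      ring
    rw [← dist_eq_norm]
    calc dist (η k) (η n) ≤ ∑ j ∈ Finset.Ico k n, dist (η j) (η (j + 1)) :=
          dist_le_Ico_sum_dist η hkn.le
      _ ≤ ∑ j ∈ Finset.Ico k n, (δ' / (2 * (T + 1)) * γ j + C * (γ j * A j)) :=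
          Finset.sum_le_sum hstep
      _ = δ' / (2 * (T + 1)) * ∑ j ∈ Finset.Ico k n, γ j +
          C * ∑ j ∈ Finset.Ico k n, γ j * A j := by
          rw [Finset.sum_add_distrib, Finset.mul_sum, Finset.mul_sum]
      _ ≤ δ' / (2 * (T + 1)) * (T + 1) + C * (2 * ε) := by gcongr
      _ = 3 / 4 * δ' := by rw [hε]; field_simp; ring
      _ < δ' := by linarith
  -- All targets of the window lie within `δ / 4` of the last one, so the recursion contracts
  -- towards `G n`, contradicting `δ ≤ ‖G n - x n‖`.
  have hcontr := norm_sub_le_exp_mul_add hγ hrec (c := G n) (ρ := δ / 2) (by positivity) hmn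
    fun k hk hkn => by
      have h1 := hGδ k n (hclose k hk hkn)
      have h2 := (hN k (hm.trans hk)).2
      calc ‖G k + e k - G n‖ = ‖(G k - G n) + e k‖ := by congr 1; abel
        _ ≤ ‖G k - G n‖ + ‖e k‖ := norm_add_le _ _
        _ ≤ δ / 2 := by linarith
  have h1 : Real.exp (-∑ k ∈ Finset.Ico m n, γ k) * ‖x m - G n‖ ≤ Real.exp (-T) * D :=
    mul_le_mul (Real.exp_le_exp.2 (by linarith)) (hD m n) (norm_nonneg _) (Real.exp_pos _).le
  rw [norm_sub_rev] at hδn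
  linarith

theorem tendsto_sum_Ico_atTop {γ : ℕ → ℝ}
    (hsum : Tendsto (fun n => ∑ k ∈ Finset.range n, γ k) atTop atTop) (m : ℕ) :
    Tendsto (fun n => ∑ k ∈ Finset.Ico m n, γ k) atTop atTop := by
  refine (tendsto_atTop_add_const_right _ (-∑ k ∈ Finset.range m, γ k) hsum).congr' ?_
  filter_upwards [eventually_ge_atTop m] with n hn
  rw [Finset.sum_Ico_eq_sub _ hn, sub_eq_add_neg]

/-- A late upcrossing must enter a band where `ρ ≥ δ`. A window ending there has lost `ε`, so it
would have to start above the level being reached for the first time. -/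
theorem tendsto_of_forall_exists_decrease {γ : ℕ → ℝ} (hγ : ∀ n, 0 < γ n ∧ γ n < 1)
    {W ρ : ℕ → ℝ}
    (hstep : ∀ ε > 0, ∀ᶠ n in atTop, W (n + 1) ≤ W n + γ n * ε)
    (hdec : ∀ δ > 0, ∃ T > 0, ∃ ε > 0, ∃ N, ∀ m n, N ≤ m → m ≤ n →
      T ≤ ∑ k ∈ Finset.Ico m n, γ k → ∑ k ∈ Finset.Ico m n, γ k ≤ T + 1 → δ ≤ ρ n → W n ≤ W m - ε)
    (hgap : ∀ a b, a < b → ∃ c, ∃ r > 0, a ≤ c - 2 * r ∧ c + 2 * r ≤ b ∧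
      ∃ δ > 0, ∀ n, |W n - c| ≤ 2 * r → δ ≤ ρ n)
    (hbdd : ∃ B, ∀ n, |W n| ≤ B) :
    ∃ l, Tendsto W atTop (𝓝 l) := by
  obtain ⟨B, hB⟩ := hbdd
  refine tendsto_of_no_upcrossings dense_univ ?_
    (isBoundedUnder_of ⟨B, fun n => (abs_le.1 (hB n)).2⟩)
    (isBoundedUnder_of ⟨-B, fun n => (abs_le.1 (hB n)).1⟩)
  rintro a - b - hab ⟨hfa, hfb⟩
  obtain ⟨c, r, hr, hac, hcb, δ, hδ, hgapδ⟩ := hgap a b hab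
  obtain ⟨T, hT, ε, hε, N, hN⟩ := hdec δ hδ
  obtain ⟨N₂, hN₂⟩ := eventually_atTop.1 (hstep (r / (T + 1)) (by positivity))
  obtain ⟨m, hm, hWm⟩ := (frequently_atTop.1 hfa) (max N N₂)
  have hex : ∃ n, m ≤ n ∧ c + r ≤ W n := by
    obtain ⟨n, hn, hWn⟩ := (frequently_atTop.1 hfb) m
    exact ⟨n, hn, by linarith⟩
  classical
  -- First passage above `c + r` after `m`. One step rises by at most `r`, so `W n₀` is still in the
  -- band.
  set n₀ := Nat.find hex with hn₀
  obtain ⟨hmn, hWn₀⟩ := Nat.find_spec hex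
  have hmin : ∀ k, m ≤ k → k < n₀ → W k < c + r := fun k hk hkn => by
    have := Nat.find_min hex hkn
    push Not at this
    exact this hk
  rw [← hn₀] at hmn hWn₀
  have hrT : r / (T + 1) ≤ r := div_le_self hr.le (by linarith)
  have hmlt : m < n₀ := lt_of_le_of_ne hmn fun h => by rw [← h] at hWn₀; linarith
  have hub : W n₀ ≤ c + 2 * r := by
    obtain ⟨k, hk⟩ := Nat.exists_eq_succ_of_ne_zero (by omega : n₀ ≠ 0)
    have h1 := hmin k (by omega) (by omega)
    have h2 := hN₂ k (by omega)
    have h3 : γ k * (r / (T + 1)) ≤ 1 * r :=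
      mul_le_mul (hγ k).2.le hrT (by positivity) zero_le_one
    rw [hk, Nat.succ_eq_add_one]
    linarith
  have hρ : δ ≤ ρ n₀ := hgapδ n₀ (abs_le.2 ⟨by linarith, by linarith⟩)
  -- In time at most `T + 1`, `W` rises by at most `r` and cannot get from below `c - 2 * r` to `c +
  -- r`. Otherwise a full window fits between `m` and `n₀`.
  rcases le_or_gt (∑ k ∈ Finset.Ico m n₀, γ k) (T + 1) with hle | hgt
  · have h1 := le_sub_sum_add_mul (W := W) (A := 0) (γ := γ) hmn
      fun k hk => by simpa using hN₂ k (by omega)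
    have h2 : r / (T + 1) * ∑ k ∈ Finset.Ico m n₀, γ k ≤ r / (T + 1) * (T + 1) :=
      mul_le_mul_of_nonneg_left hle (by positivity)
    rw [div_mul_cancel₀ _ (by linarith : T + 1 ≠ 0)] at h2
    simp only [Pi.zero_apply, mul_zero, Finset.sum_const_zero] at h1
    linarith
  · obtain ⟨m', hm', hmn', hT1, hT2⟩ := exists_window hγ hT hmn (by linarith)
    have h1 := hN m' n₀ (by omega) hmn'.le hT1 hT2 hρ
    linarith [hmin m' hm' hmn']

/-- A late `n` with `ρ n ≥ δ` would end a window over which `W` drops by `ε`, although both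
endpoints are within `ε / 2` of the limit. -/
theorem tendsto_zero_of_forall_exists_decrease {γ : ℕ → ℝ} (hγ : ∀ n, 0 < γ n ∧ γ n < 1)
    (hsum : Tendsto (fun n => ∑ k ∈ Finset.range n, γ k) atTop atTop)
    {W ρ : ℕ → ℝ} (hρ : ∀ n, 0 ≤ ρ n)
    (hdec : ∀ δ > 0, ∃ T > 0, ∃ ε > 0, ∃ N, ∀ m n, N ≤ m → m ≤ n →
      T ≤ ∑ k ∈ Finset.Ico m n, γ k → ∑ k ∈ Finset.Ico m n, γ k ≤ T + 1 → δ ≤ ρ n → W n ≤ W m - ε)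
    {l : ℝ} (hW : Tendsto W atTop (𝓝 l)) : Tendsto ρ atTop (𝓝 0) := by
  rw [Metric.tendsto_nhds]
  intro δ hδ
  obtain ⟨T, hT, ε, hε, N, hN⟩ := hdec δ hδ
  obtain ⟨N₂, hN₂⟩ := eventually_atTop.1
    ((Metric.tendsto_nhds.1 hW) (ε / 2) (half_pos hε))
  filter_upwards [(tendsto_sum_Ico_atTop hsum (max N N₂)).eventually_ge_atTop T,
    eventually_ge_atTop (max N N₂)] with n hTn hn
  rw [Real.dist_eq, sub_zero, abs_of_nonneg (hρ n)]
  by_contra! hge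
  obtain ⟨m, hm, hmn, hT1, hT2⟩ := exists_window hγ hT hn hTn
  have h1 := hN m n (by omega) hmn.le hT1 hT2 hge
  have h2 := abs_lt.1 (hN₂ m (by omega))
  have h3 := abs_lt.1 (hN₂ n (by omega))
  linarith [h2.2, h3.1]

/-- Convergence of a perturbed Robbins-Monro recursion `x (n + 1) = x n + γ n • (h (x n) + e n)`
to the zeros of `h`.  The function `w` is nonincreasing along the mean field `h`; where its
derivative along `h` vanishes, only the derivative of `η` along `h` is known to vanish, and `η`
determines the target `x + h x`. -/
theorem tendsto_meanField_zero [NormedSpace ℝ F] {U K : Set E} (hU : IsOpen U)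
    (hK : IsCompact K) (hKU : K ⊆ U)
    {h : E → E} (hh : ContinuousOn h U)
    {w : E → ℝ} {w' : E → E →L[ℝ] ℝ} (hw : ∀ s ∈ U, HasFDerivAt w (w' s) s)
    (hw' : ContinuousOn w' U)
    {η : E → F} {η' : E → E →L[ℝ] F} (hη : ∀ s ∈ U, HasFDerivAt η (η' s) s)
    (hη' : ContinuousOn η' U)
    (hdecr : ∀ s ∈ U, w' s (h s) ≤ 0) (hzero : ∀ s ∈ U, w' s (h s) = 0 → η' s (h s) = 0)
    (htarget : ∀ s ∈ U, ∀ t ∈ U, η s = η t → s + h s = t + h t)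
    (hcrit : IsNowhereDense (w '' {s ∈ U | h s = 0}))
    {γ : ℕ → ℝ} (hγ : ∀ n, 0 < γ n ∧ γ n < 1) (hγ0 : Tendsto γ atTop (𝓝 0))
    (hsum : Tendsto (fun n => ∑ k ∈ Finset.range n, γ k) atTop atTop)
    {x e : ℕ → E} (hx : ∀ n, x n ∈ K) (he : Tendsto e atTop (𝓝 0))
    (hrec : ∀ n, x (n + 1) = x n + γ n • (h (x n) + e n)) :
    Tendsto (fun n => h (x n)) atTop (𝓝 0) := by
  have hγp : ∀ n, 0 < γ n := fun n => (hγ n).1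
  have hhK := hh.mono hKU
  have hwc : ContinuousOn w K := fun s hs => (hw s (hKU hs)).continuousAt.continuousWithinAt
  have hηc : ContinuousOn η K := fun s hs => (hη s (hKU hs)).continuousAt.continuousWithinAt
  have hac : ContinuousOn (fun s => -w' s (h s)) K := ((hw'.mono hKU).clm_apply hhK).neg
  have hbc : ContinuousOn (fun s => ‖η' s (h s)‖) K := ((hη'.mono hKU).clm_apply hhK).norm
  have hGc : ContinuousOn (fun s => s + h s) K := continuousOn_id.add hhK
  have hW : ∀ ε > 0, ∀ᶠ n in atTop,
      w (x (n + 1)) ≤ w (x n) - γ n * -w' (x n) (h (x n)) + γ n * ε := by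
    intro ε hε
    filter_upwards [eventually_norm_sub_sub_smul_le hU hK hKU hw hw' hh hγp hγ0 hx he hrec hε]
      with n hn
    have := (abs_le.1 hn).2
    rw [smul_eq_mul] at this
    linarith
  have hN : ∀ ε > 0, ∀ᶠ n in atTop,
      ‖η (x (n + 1)) - η (x n)‖ ≤ γ n * (‖η' (x n) (h (x n))‖ + ε) := by
    intro ε hε
    filter_upwards [eventually_norm_sub_sub_smul_le hU hK hKU hη hη' hh hγp hγ0 hx he hrec hε]
      with n hn
    have h1 := norm_le_norm_add_norm_sub' (η (x (n + 1)) - η (x n))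
      (γ n • η' (x n) (h (x n)))
    rw [norm_smul, Real.norm_of_nonneg (hγp n).le] at h1
    rw [mul_add]
    linarith
  obtain ⟨B, hB⟩ := hK.exists_bound_of_continuousOn continuousOn_id
  obtain ⟨B', hB'⟩ := hK.exists_bound_of_continuousOn hGc
  have hdec := fun (δ : ℝ) (hδ : 0 < δ) => exists_decrease_of_le_norm hγ (x := x)
    (G := fun n => x n + h (x n)) (e := e) (η := fun n => η (x n)) (W := fun n => w (x n))
    (A := fun n => -w' (x n) (h (x n))) (b := fun n => ‖η' (x n) (h (x n))‖) (D := B + B')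
    (fun n => by rw [hrec]; congr 2; abel) he
    (fun n => neg_nonneg.2 (hdecr _ (hKU (hx n))))
    (fun m n => (norm_sub_le _ _).trans (add_le_add (hB _ (hx m)) (hB' _ (hx n)))) hW hN
    (fun κ hκ => by
      obtain ⟨C, hC, hCK⟩ := exists_forall_le_add_mul_of_isCompact hK hac hbc
        (fun s hs => neg_nonneg.2 (hdecr _ (hKU hs)))
        (fun s hs h0 => norm_eq_zero.2 (hzero s (hKU hs) (neg_eq_zero.1 h0))) hκ
      exact ⟨C, hC, fun n => hCK _ (hx n)⟩)
    (fun ε hε => by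
      -- Compactness of `K ×ˢ K` makes the dependence of the target on η uniformly continuous.
      obtain ⟨δ, hδ, hδK⟩ := exists_pos_forall_lt_of_isCompact (hK.prod hK)
        (f := fun z => ‖η z.1 - η z.2‖) (g := fun z => ‖(z.1 + h z.1) - (z.2 + h z.2)‖)
        ((hηc.comp continuousOn_fst fun z hz => hz.1).sub
          (hηc.comp continuousOn_snd fun z hz => hz.2)).norm
        ((hGc.comp continuousOn_fst fun z hz => hz.1).sub
          (hGc.comp continuousOn_snd fun z hz => hz.2)).norm
        (fun _ _ => norm_nonneg _)
        (fun z hz h0 => norm_eq_zero.2 (sub_eq_zero.2 (htarget _ (hKU hz.1) _ (hKU hz.2)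
          (sub_eq_zero.1 (norm_eq_zero.1 h0))))) hε
      exact ⟨δ, hδ, fun m n => hδK (x m, x n) ⟨hx m, hx n⟩⟩) hδ
  simp only [add_sub_cancel_left] at hdec
  obtain ⟨l, hl⟩ := tendsto_of_forall_exists_decrease hγ (W := fun n => w (x n))
    (ρ := fun n => ‖h (x n)‖)
    (fun ε hε => by
      filter_upwards [hW ε hε] with n hn
      have := mul_nonneg (hγp n).le (neg_nonneg.2 (hdecr _ (hKU (hx n))))
      linarith)
    hdec
    (fun a b hab => by
      obtain ⟨c, hc, hcw⟩ : ∃ c ∈ Set.Ioo a b, c ∉ closure (w '' {s ∈ U | h s = 0}) := by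
        by_contra! hcon
        have hsub := interior_maximal (s := closure (w '' {s ∈ U | h s = 0})) hcon isOpen_Ioo
        rw [IsNowhereDense] at hcrit
        rw [hcrit] at hsub
        exact (Set.nonempty_Ioo.2 hab).ne_empty (Set.subset_empty_iff.1 hsub)
      obtain ⟨R, hR, hRsub⟩ := Metric.isOpen_iff.1
        ((isOpen_Ioo (a := a) (b := b)).sdiff
          (isClosed_closure (s := w '' {s ∈ U | h s = 0}))) c ⟨hc, hcw⟩
      have hsub : ∀ z, |z - c| < R → z ∈ Set.Ioo a b \ closure (w '' {s ∈ U | h s = 0}) :=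
        fun z hz => hRsub (by rwa [Metric.mem_ball, Real.dist_eq])
      refine ⟨c, R / 4, by positivity, ?_, ?_, ?_⟩
      · exact (hsub (c - 2 * (R / 4)) (by rw [abs_lt]; constructor <;> linarith)).1.1.le
      · exact (hsub (c + 2 * (R / 4)) (by rw [abs_lt]; constructor <;> linarith)).1.2.le
      -- The tent function of `w s` centred at `c` vanishes at zeros of `h`, whose values are at
      -- distance at least `R` from `c`. It is at least `R / 2` on the band, so `‖h‖` is bounded
      -- below there.
      obtain ⟨δ, hδ, hδK⟩ := exists_pos_forall_lt_of_isCompact hK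
        (f := fun s => ‖h s‖) (g := fun s => max 0 (R - |w s - c|)) (ε := R / 2) hhK.norm
        (ContinuousOn.sup continuousOn_const
          (continuousOn_const.sub (hwc.sub continuousOn_const).abs))
        (fun _ _ => norm_nonneg _)
        (fun s hs h0 => by
          rw [max_eq_left]
          by_contra! hlt
          exact (hsub (w s) (by linarith)).2
            (subset_closure ⟨s, ⟨hKU hs, norm_eq_zero.1 h0⟩, rfl⟩)) (by positivity)
      refine ⟨δ, hδ, fun n hn => ?_⟩
      by_contra! hlt
      have := (le_max_right _ _).trans_lt (hδK _ (hx n) hlt)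
      linarith)
    (by
      obtain ⟨C, hC⟩ := hK.exists_bound_of_continuousOn hwc
      exact ⟨C, fun n => hC _ (hx n)⟩)
  exact tendsto_zero_iff_norm_tendsto_zero.2 (tendsto_zero_of_forall_exists_decrease hγ hsum
    (W := fun n => w (x n)) (fun n => norm_nonneg _) hdec hl)

end Recursion

/-! ### Subgradients and positive semidefinite Hessians. -/

section InnerProduct

variable {E : Type*} [NormedAddCommGroup E] [InnerProductSpace ℝ E]

/-- Along `u + t • A u` the form equals `2 * t * ‖A u‖ ^ 2 + O(t ^ 2)`, which is negative for small
negative `t` unless `A u = 0`. -/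
theorem apply_eq_zero_of_inner_apply_self_eq_zero {A : E →L[ℝ] E}
    (hsymm : ∀ u v, ⟪A u, v⟫ = ⟪A v, u⟫)
    (hpos : ∀ u, 0 ≤ ⟪A u, u⟫) {u : E} (hu : ⟪A u, u⟫ = 0) : A u = 0 := by
  by_contra hne
  set c := ⟪A (A u), A u⟫ with hc
  have hc0 : 0 ≤ c := hpos _
  have ha : 0 < ⟪A u, A u⟫ := real_inner_self_pos.2 hne
  set a := ⟪A u, A u⟫ with haa
  have hquad : ∀ t : ℝ, 0 ≤ 2 * t * a + t ^ 2 * c := fun t => by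
    have h1 := hpos (u + t • A u)
    have h2 : ⟪A (A u), u⟫ = a := by rw [hsymm]
    simp only [map_add, map_smul, inner_add_left, inner_add_right, real_inner_smul_left,
      real_inner_smul_right, hu, h2, ← hc, ← haa] at h1
    linarith
  -- Near the minimiser `-a / c`; the `+ 1` covers `c = 0`.
  have h5 := hquad (-a / (c + 1))
  have h6 : 2 * (-a / (c + 1)) * a + (-a / (c + 1)) ^ 2 * c =
      -(a ^ 2 * (c + 2)) / (c + 1) ^ 2 := by field_simp; ring
  rw [h6, le_div_iff₀ (by positivity), zero_mul] at h5
  have : 0 < a ^ 2 * (c + 2) := by positivity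
  linarith

/-- Monotonicity makes the difference quotients along `u` have nonnegative inner product with `u`.
-/
theorem inner_apply_self_nonneg_of_monotone {U : Set E} (hU : IsOpen U) {η : E → E}
    (hmono : ∀ s ∈ U, ∀ t ∈ U, 0 ≤ ⟪η s - η t, s - t⟫) {η' : E →L[ℝ] E} {s : E} (hs : s ∈ U)
    (hη : HasFDerivAt η η' s) (u : E) : 0 ≤ ⟪η' u, u⟫ := by
  have hline : HasDerivAt (fun t : ℝ => s + t • u) u 0 := by
    simpa using ((hasDerivAt_id (0 : ℝ)).smul_const u).const_add s
  have hd : HasDerivAt (fun t : ℝ => η (s + t • u)) (η' u) 0 := by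
    have hη0 : HasFDerivAt η η' (s + (0 : ℝ) • u) := by simpa using hη
    exact hη0.comp_hasDerivAt 0 hline
  have hlim := Filter.Tendsto.inner (𝕜 := ℝ) hd.tendsto_slope_zero_right
    (tendsto_const_nhds (x := u))
  refine ge_of_tendsto hlim ?_
  have hmem : ∀ᶠ t : ℝ in 𝓝[>] 0, s + t • u ∈ U := by
    refine nhdsWithin_le_nhds (hline.continuousAt.eventually_mem (hU.mem_nhds ?_))
    simpa using hs
  filter_upwards [hmem, self_mem_nhdsWithin] with t ht htpos
  have htpos : 0 < t := htpos
  have h1 := hmono _ ht _ hs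
  rw [add_sub_cancel_left, real_inner_smul_right] at h1
  simp only [zero_add, zero_smul, add_zero, real_inner_smul_left]
  exact mul_nonneg (inv_nonneg.2 htpos.le) (nonneg_of_mul_nonneg_right h1 htpos)

/-- A continuous selection of subgradients is the gradient. -/
theorem hasFDerivAt_of_forall_inner_le {U : Set E} (hU : IsOpen U) {V : E → ℝ} {η : E → E}
    (hη : ContinuousOn η U) (hV : ∀ s ∈ U, ∀ t ∈ U, ⟪η s, t - s⟫ ≤ V t - V s) {s : E}
    (hs : s ∈ U) : HasFDerivAt V (innerSL ℝ (η s)) s := by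
  rw [hasFDerivAt_iff_isLittleO, Asymptotics.isLittleO_iff]
  intro c hc
  have hηs := (Metric.tendsto_nhds.1 (hη.continuousAt (hU.mem_nhds hs))) c hc
  filter_upwards [hηs, hU.mem_nhds hs] with t ht htU
  rw [dist_eq_norm] at ht
  -- The subgradient inequalities at `s` and at `t` enclose `V t - V s` between `⟪η s, t - s⟫` and
  -- `⟪η t, t - s⟫`.
  have h1 := hV s hs t htU
  have h2 := hV t htU s hs
  have h3 : ⟪η t, s - t⟫ = - ⟪η t, t - s⟫ := by rw [← inner_neg_right, neg_sub]
  have h4 := (real_inner_le_norm (η t - η s) (t - s)).trans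
    (mul_le_mul_of_nonneg_right ht.le (norm_nonneg _))
  rw [inner_sub_left] at h4
  rw [innerSL_apply_apply, Real.norm_eq_abs, abs_le]
  constructor <;> nlinarith [norm_nonneg (t - s)]

/-- `η` is the gradient of `V`, so `η'` is a second derivative and hence symmetric. -/
theorem inner_fderiv_symm_of_forall_inner_le {U : Set E} (hU : IsOpen U) {V : E → ℝ} {η : E → E}
    (hη : ContinuousOn η U) (hV : ∀ s ∈ U, ∀ t ∈ U, ⟪η s, t - s⟫ ≤ V t - V s) {s : E}
    (hs : s ∈ U) {η' : E →L[ℝ] E} (hη' : HasFDerivAt η η' s) (u v : E) :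
    ⟪η' u, v⟫ = ⟪η' v, u⟫ := by
  have h1 : ∀ᶠ t in 𝓝 s, HasFDerivAt V (innerSL ℝ (η t)) t :=
    Eventually.mono (hU.mem_nhds hs) fun t ht => hasFDerivAt_of_forall_inner_le hU hη hV ht
  have h2 : HasFDerivAt (fun t => innerSL ℝ (η t)) ((innerSL ℝ).comp η') s :=
    (innerSL ℝ (E := E)).hasFDerivAt.comp s hη'
  have := second_derivative_symmetric_of_eventually h1 h2 u v
  simpa using this

end InnerProduct

/-! ### The EM inequality, the gradient of the divergence and the Lyapunov function. -/

namespace LatentModel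

variable {𝒳 𝒴 : Type*} [MeasurableSpace 𝒳] [MeasurableSpace 𝒴] {d m : ℕ}
  {M : LatentModel 𝒳 𝒴 d m} {𝒮 : Set (EuclideanSpace ℝ (Fin d))} {p : 𝒴 → ℝ}

theorem isProbabilityMeasure_obsLaw (hp : M.IsObsDensity p) : IsProbabilityMeasure (M.obsLaw p) :=
  ⟨by rw [obsLaw, withDensity_apply _ MeasurableSet.univ, Measure.restrict_univ,
    hp.lintegral_eq_one]⟩

theorem thetaBar_spec (hexp : M.ExponentialAssumption 𝒮) {s : EuclideanSpace ℝ (Fin d)}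
    (hs : s ∈ 𝒮) : M.thetaBar s ∈ M.Θ ∧ IsMaxOn (M.ell s) M.Θ (M.thetaBar s) :=
  Classical.epsilon_spec (p := fun θ => θ ∈ M.Θ ∧ IsMaxOn (M.ell s) M.Θ θ)
    (hexp.existsUnique_max s hs).exists

theorem f_nonneg (hM : M.IsLatentFamily) (x : 𝒳) (θ : EuclideanSpace ℝ (Fin m)) : 0 ≤ M.f x θ :=
  mul_nonneg (hM.h_nonneg x) (Real.exp_pos _).le

theorem f_eq_mul_exp (x : 𝒳) (θ θ' : EuclideanSpace ℝ (Fin m)) :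
    M.f x θ' = M.f x θ * Real.exp (M.ψ θ - M.ψ θ' + ⟪M.S x, M.φ θ' - M.φ θ⟫) := by
  rw [f, f, mul_assoc, ← Real.exp_add, inner_sub_right]
  congr 2
  ring

/-- The observed log-likelihood increases at least as much as the intermediate quantity of EM. -/
theorem le_log_g_sub_log_g (hM : M.IsLatentFamily) (hexp : M.ExponentialAssumption 𝒮) (y : 𝒴)
    {θ θ' : EuclideanSpace ℝ (Fin m)} (hθ : θ ∈ M.Θ) (hθ' : θ' ∈ M.Θ) :
    M.ψ θ - M.ψ θ' + ⟪M.condStat y θ, M.φ θ' - M.φ θ⟫ ≤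
      Real.log (M.g y θ') - Real.log (M.g y θ) := by
  obtain ⟨hg, hfi, hfS⟩ := hexp.condStat_wellDefined y θ hθ
  obtain ⟨hg', hfi', -⟩ := hexp.condStat_wellDefined y θ' hθ'
  set v := M.φ θ' - M.φ θ with hv
  set c := M.ψ θ - M.ψ θ' + ⟪M.condStat y θ, v⟫ with hc
  have hint : Integrable (fun x => ⟪M.f x θ • M.S x, v⟫) (M.fiber y) := hfS.inner_const v
  have hSv : ∫ x, ⟪M.f x θ • M.S x, v⟫ ∂(M.fiber y) = M.g y θ * ⟪M.condStat y θ, v⟫ := by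
    have h1 : ∫ x, ⟪M.f x θ • M.S x, v⟫ ∂(M.fiber y) =
        ⟪∫ x, M.f x θ • M.S x ∂(M.fiber y), v⟫ := by
      simp_rw [real_inner_comm v]
      exact integral_inner hfS v
    rw [h1, condStat, real_inner_smul_left, mul_inv_cancel_left₀ hg.ne']
  -- Jensen's inequality by the tangent of `exp` at the conditional mean `c` of the log-ratio; the
  -- linear term integrates to zero.
  have hle : ∫ x, Real.exp c * ((1 + (M.ψ θ - M.ψ θ' - c)) * M.f x θ + ⟪M.f x θ • M.S x, v⟫)
      ∂(M.fiber y) ≤ M.g y θ' := by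
    refine integral_mono (((hfi.const_mul _).add hint).const_mul _) hfi' fun x => ?_
    rw [f_eq_mul_exp x θ θ', ← hv, real_inner_smul_left]
    set Δ := M.ψ θ - M.ψ θ' + ⟪M.S x, v⟫ with hΔ
    have h1 : Real.exp c * (1 + (Δ - c)) ≤ Real.exp Δ := by
      have := mul_le_mul_of_nonneg_left (Real.add_one_le_exp (Δ - c)) (Real.exp_pos c).le
      rw [← Real.exp_add, add_sub_cancel] at this
      linarith
    have h2 := mul_le_mul_of_nonneg_left h1 (f_nonneg hM x θ)
    rw [hΔ] at h2 ⊢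
    linarith
  rw [integral_const_mul, integral_add (hfi.const_mul _) hint, integral_const_mul, hSv] at hle
  have hle' : Real.exp c * M.g y θ ≤ M.g y θ' := by
    refine le_trans (le_of_eq ?_) hle
    change _ = Real.exp c * ((1 + (M.ψ θ - M.ψ θ' - c)) * M.g y θ + _)
    rw [hc]; ring
  have hlog := Real.log_le_log (by positivity) hle'
  rw [Real.log_mul (Real.exp_pos c).ne' hg.ne', Real.log_exp] at hlog
  linarith

theorem kl_sub_kl_le (hM : M.IsLatentFamily) (hp : M.IsObsDensity p)
    (hexp : M.ExponentialAssumption 𝒮) (hobs : M.ObservedRegularity p)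
    {θ θ' : EuclideanSpace ℝ (Fin m)} (hθ : θ ∈ M.Θ) (hθ' : θ' ∈ M.Θ)
    (hint : Integrable (fun y => M.condStat y θ) (M.obsLaw p)) :
    M.kl p θ' - M.kl p θ ≤
      M.ψ θ' - M.ψ θ - ⟪∫ y, M.condStat y θ ∂(M.obsLaw p), M.φ θ' - M.φ θ⟫ := by
  have := isProbabilityMeasure_obsLaw hp
  set v := M.φ θ' - M.φ θ with hv
  have hinner : ⟪∫ y, M.condStat y θ ∂(M.obsLaw p), v⟫ =
      ∫ y, ⟪M.condStat y θ, v⟫ ∂(M.obsLaw p) := by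
    simp_rw [real_inner_comm v]
    exact (integral_inner hint v).symm
  have hrhs : ∫ y, (M.ψ θ' - M.ψ θ - ⟪M.condStat y θ, v⟫) ∂(M.obsLaw p) =
      M.ψ θ' - M.ψ θ - ⟪∫ y, M.condStat y θ ∂(M.obsLaw p), v⟫ := by
    rw [integral_sub (integrable_const _) (hint.inner_const v), hinner]
    simp
  rw [← hrhs, kl, kl, ← integral_sub (hobs.integrable_kl θ' hθ') (hobs.integrable_kl θ hθ)]
  refine integral_mono_ae ((hobs.integrable_kl θ' hθ').sub (hobs.integrable_kl θ hθ))
    ((integrable_const _).sub (hint.inner_const v)) ?_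
  -- Splitting `log (p y / g)` needs `p y ≠ 0`; then the terms `log (p y)` cancel in the difference.
  have hpos : ∀ᵐ y ∂(M.obsLaw p), 0 < p y := by
    rw [obsLaw, ae_withDensity_iff hp.measurable.ennreal_ofReal]
    exact Eventually.of_forall fun y hy => by simpa using hy
  filter_upwards [hpos] with y hy
  have hg := (hexp.condStat_wellDefined y θ hθ).1
  have hg' := (hexp.condStat_wellDefined y θ' hθ').1
  simp only [Real.log_div hy.ne' hg.ne', Real.log_div hy.ne' hg'.ne']
  linarith [le_log_g_sub_log_g hM hexp y hθ hθ']

/-- The EM upper bound minus the divergence has a local minimum at `θ`, so the two derivatives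
agree; no differentiation under the integral is needed. -/
theorem hasFDerivAt_kl (hM : M.IsLatentFamily) (hp : M.IsObsDensity p)
    (hexp : M.ExponentialAssumption 𝒮) (hobs : M.ObservedRegularity p) (hΘ : IsOpen M.Θ)
    {θ : EuclideanSpace ℝ (Fin m)} (hθ : θ ∈ M.Θ)
    (hint : Integrable (fun y => M.condStat y θ) (M.obsLaw p))
    {ψ' : EuclideanSpace ℝ (Fin m) →L[ℝ] ℝ}
    {φ' : EuclideanSpace ℝ (Fin m) →L[ℝ] EuclideanSpace ℝ (Fin d)}
    (hψ : HasFDerivAt M.ψ ψ' θ) (hφ : HasFDerivAt M.φ φ' θ) :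
    HasFDerivAt (M.kl p)
      (ψ' - (innerSL ℝ (∫ y, M.condStat y θ ∂(M.obsLaw p))).comp φ') θ := by
  set H := ∫ y, M.condStat y θ ∂(M.obsLaw p) with hH
  have hkl := (hobs.differentiableOn_kl.differentiableAt (hΘ.mem_nhds hθ)).hasFDerivAt
  have hq : HasFDerivAt (fun θ' => M.ψ θ' - innerSL ℝ H (M.φ θ'))
      (ψ' - (innerSL ℝ H).comp φ') θ :=
    hψ.sub ((innerSL ℝ H).hasFDerivAt.comp θ hφ)
  have hmin : IsLocalMin (fun θ' => (M.ψ θ' - innerSL ℝ H (M.φ θ')) - M.kl p θ') θ := by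
    filter_upwards [hΘ.mem_nhds hθ] with θ' hθ'
    have := kl_sub_kl_le hM hp hexp hobs hθ hθ' hint
    rw [← hH, inner_sub_right] at this
    simp only [innerSL_apply_apply]
    linarith
  have := hmin.hasFDerivAt_eq_zero (hq.sub hkl)
  rw [sub_eq_zero] at this
  rwa [this]

theorem fderiv_psi_eq (hexp : M.ExponentialAssumption 𝒮) (hΘ : IsOpen M.Θ)
    {s : EuclideanSpace ℝ (Fin d)} (hs : s ∈ 𝒮) {ψ' : EuclideanSpace ℝ (Fin m) →L[ℝ] ℝ}
    {φ' : EuclideanSpace ℝ (Fin m) →L[ℝ] EuclideanSpace ℝ (Fin d)}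
    (hψ : HasFDerivAt M.ψ ψ' (M.thetaBar s)) (hφ : HasFDerivAt M.φ φ' (M.thetaBar s)) :
    ψ' = (innerSL ℝ s).comp φ' := by
  obtain ⟨hθ, hmax⟩ := thetaBar_spec hexp hs
  have h1 : HasFDerivAt (M.ell s) (-ψ' + (innerSL ℝ s).comp φ') (M.thetaBar s) :=
    hψ.neg.add ((innerSL ℝ s).hasFDerivAt.comp _ hφ)
  have h2 := (hmax.isLocalMax (hΘ.mem_nhds hθ)).hasFDerivAt_eq_zero h1
  rw [neg_add_eq_zero] at h2
  exact h2

/-- Stationarity of `ℓ(s; ·)` at θ̄(s) replaces the derivative of ψ by ⟨s, Dφ ·⟩, so that only the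
mean field E_π[s̄] - s remains. -/
theorem hasFDerivAt_kl_thetaBar (hM : M.IsLatentFamily) (hp : M.IsObsDensity p)
    (hexp : M.ExponentialAssumption 𝒮) (hreg : M.RegularityAssumption 𝒮 p)
    (hobs : M.ObservedRegularity p) {s : EuclideanSpace ℝ (Fin d)} (hs : s ∈ 𝒮)
    (hint : Integrable (fun y => M.condStat y (M.thetaBar s)) (M.obsLaw p)) :
    HasFDerivAt (M.kl p)
      (-(innerSL ℝ (M.meanField p s)).comp (fderiv ℝ M.φ (M.thetaBar s))) (M.thetaBar s) := by
  have hθ := (thetaBar_spec hexp hs).1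
  have hψ := ((hreg.contDiffOn_ψ.differentiableOn two_ne_zero).differentiableAt
    (hreg.isOpen.mem_nhds hθ)).hasFDerivAt
  have hφ := ((hreg.contDiffOn_φ.differentiableOn two_ne_zero).differentiableAt
    (hreg.isOpen.mem_nhds hθ)).hasFDerivAt
  have h := hasFDerivAt_kl hM hp hexp hobs hreg.isOpen hθ hint hψ hφ
  rw [fderiv_psi_eq hexp hreg.isOpen hs hψ hφ] at h
  convert h using 1
  rw [meanField, map_sub]
  ext v
  simp

/-- Equal `φ` makes the two densities proportional, and both have total mass 1. Hence the target
depends on s only through φ(θ̄(s)). -/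
theorem condStat_eq_of_phi_eq (hM : M.IsLatentFamily) {θ θ' : EuclideanSpace ℝ (Fin m)}
    (hθ : θ ∈ M.Θ) (hθ' : θ' ∈ M.Θ) (hφ : M.φ θ = M.φ θ') (y : 𝒴) :
    M.condStat y θ = M.condStat y θ' := by
  have hf : ∀ x, M.f x θ' = M.f x θ * Real.exp (M.ψ θ - M.ψ θ') := fun x => by
    rw [f_eq_mul_exp x θ θ', hφ, sub_self, inner_zero_right, add_zero]
  have hexp : Real.exp (M.ψ θ - M.ψ θ') = 1 := by
    have h1 := hM.lintegral_f θ' hθ'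
    simp_rw [hf, ENNReal.ofReal_mul (f_nonneg hM _ θ)] at h1
    rw [lintegral_mul_const' _ _ ENNReal.ofReal_ne_top, hM.lintegral_f θ hθ, one_mul,
      ENNReal.ofReal_eq_one] at h1
    exact h1
  have hf' : ∀ x, M.f x θ = M.f x θ' := fun x => by rw [hf, hexp, mul_one]
  simp only [condStat, g, hf']

/-- Testing the maximality of θ̄(t) against θ̄(s) shows that φ(θ̄(s)) is a subgradient of the
maximum of `ℓ`. -/
theorem inner_le_ell_sub (hexp : M.ExponentialAssumption 𝒮) {s t : EuclideanSpace ℝ (Fin d)}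
    (hs : s ∈ 𝒮) (ht : t ∈ 𝒮) :
    ⟪M.φ (M.thetaBar s), t - s⟫ ≤ M.ell t (M.thetaBar t) - M.ell s (M.thetaBar s) := by
  have h := (thetaBar_spec hexp ht).2 (thetaBar_spec hexp hs).1
  simp only [ell, Set.mem_ofPred_eq] at h ⊢
  rw [real_inner_comm, inner_sub_left]
  linarith

/-- The natural parameter `φ(θ̄(s))` as a function of the sufficient statistic. -/
noncomputable def phiBar (M : LatentModel 𝒳 𝒴 d m) (s : EuclideanSpace ℝ (Fin d)) :
    EuclideanSpace ℝ (Fin d) :=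
  M.φ (M.thetaBar s)

theorem contDiffOn_phiBar (hexp : M.ExponentialAssumption 𝒮) (hreg : M.RegularityAssumption 𝒮 p) :
    ContDiffOn ℝ 1 M.phiBar 𝒮 :=
  (hreg.contDiffOn_φ.of_le one_le_two).comp hreg.contDiffOn_thetaBar
    fun _ hs => (thetaBar_spec hexp hs).1

theorem hasFDerivAt_phiBar (hexp : M.ExponentialAssumption 𝒮) (hreg : M.RegularityAssumption 𝒮 p)
    {s : EuclideanSpace ℝ (Fin d)} (hs : s ∈ 𝒮) :
    HasFDerivAt M.phiBar (fderiv ℝ M.phiBar s) s :=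
  (((contDiffOn_phiBar hexp hreg).differentiableOn one_ne_zero).differentiableAt
    (hexp.isOpen.mem_nhds hs)).hasFDerivAt

theorem inner_fderiv_phiBar_nonneg (hexp : M.ExponentialAssumption 𝒮)
    (hreg : M.RegularityAssumption 𝒮 p) {s : EuclideanSpace ℝ (Fin d)} (hs : s ∈ 𝒮)
    (u : EuclideanSpace ℝ (Fin d)) : 0 ≤ ⟪fderiv ℝ M.phiBar s u, u⟫ := by
  refine inner_apply_self_nonneg_of_monotone hexp.isOpen (fun s hs t ht => ?_) hs
    (hasFDerivAt_phiBar hexp hreg hs) u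
  have h1 := inner_le_ell_sub hexp hs ht
  have h2 := inner_le_ell_sub hexp ht hs
  rw [← neg_sub s t, inner_neg_right] at h1
  rw [inner_sub_left, phiBar, phiBar]
  linarith

theorem fderiv_phiBar_eq_zero (hexp : M.ExponentialAssumption 𝒮)
    (hreg : M.RegularityAssumption 𝒮 p) {s : EuclideanSpace ℝ (Fin d)} (hs : s ∈ 𝒮)
    {u : EuclideanSpace ℝ (Fin d)} (hu : ⟪fderiv ℝ M.phiBar s u, u⟫ = 0) :
    fderiv ℝ M.phiBar s u = 0 :=
  apply_eq_zero_of_inner_apply_self_eq_zero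
    (inner_fderiv_symm_of_forall_inner_le hexp.isOpen (contDiffOn_phiBar hexp hreg).continuousOn
      (fun _ hs _ ht => inner_le_ell_sub hexp hs ht) hs (hasFDerivAt_phiBar hexp hreg hs))
    (inner_fderiv_phiBar_nonneg hexp hreg hs) hu

theorem hasFDerivAt_lyapunov (hM : M.IsLatentFamily) (hp : M.IsObsDensity p)
    (hexp : M.ExponentialAssumption 𝒮) (hreg : M.RegularityAssumption 𝒮 p)
    (hobs : M.ObservedRegularity p) {s : EuclideanSpace ℝ (Fin d)} (hs : s ∈ 𝒮)
    (hint : Integrable (fun y => M.condStat y (M.thetaBar s)) (M.obsLaw p)) :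
    HasFDerivAt (M.lyapunov p)
      (-(innerSL ℝ (M.meanField p s)).comp (fderiv ℝ M.phiBar s)) s := by
  have hθ := (thetaBar_spec hexp hs).1
  have hφ := ((hreg.contDiffOn_φ.differentiableOn two_ne_zero).differentiableAt
    (hreg.isOpen.mem_nhds hθ)).hasFDerivAt
  have hb := ((hreg.contDiffOn_thetaBar.differentiableOn one_ne_zero).differentiableAt
    (hexp.isOpen.mem_nhds hs)).hasFDerivAt
  have h1 : fderiv ℝ M.phiBar s =
      (fderiv ℝ M.φ (M.thetaBar s)).comp (fderiv ℝ M.thetaBar s) := (hφ.comp s hb).fderiv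
  rw [h1, ← ContinuousLinearMap.comp_assoc, ← ContinuousLinearMap.neg_comp]
  exact (hasFDerivAt_kl_thetaBar hM hp hexp hreg hobs hs hint).comp s hb

end LatentModel

/-! ### Continuity of expectations under a local L² bound. -/

theorem le_min_add_sq_div (a : ℝ≥0∞) {R : ℝ≥0∞} (hR0 : R ≠ 0) (hR : R ≠ ∞) :
    a ≤ min a R + a ^ 2 / R := by
  rcases le_total a R with h | h
  · rw [min_eq_left h]; exact le_self_add
  · refine le_trans ?_ le_add_self
    rw [ENNReal.le_div_iff_mul_le (Or.inl hR0) (Or.inl hR), sq]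
    exact mul_le_mul_right h a

theorem enorm_sub_sq_le {E : Type*} [SeminormedAddCommGroup E] (a b : E) :
    ‖a - b‖ₑ ^ 2 ≤ 2 * ‖a‖ₑ ^ 2 + 2 * ‖b‖ₑ ^ 2 := by
  have h1 : ‖a - b‖ ^ 2 ≤ 2 * ‖a‖ ^ 2 + 2 * ‖b‖ ^ 2 := by
    have h2 := pow_le_pow_left₀ (norm_nonneg _) (norm_sub_le a b) 2
    nlinarith [sq_nonneg (‖a‖ - ‖b‖)]
  have h2 := ENNReal.ofReal_le_ofReal h1
  rw [ENNReal.ofReal_add (by positivity) (by positivity), ENNReal.ofReal_mul (by norm_num),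
    ENNReal.ofReal_mul (by norm_num), ENNReal.ofReal_pow (norm_nonneg _),
    ENNReal.ofReal_pow (norm_nonneg _), ENNReal.ofReal_pow (norm_nonneg _)] at h2
  simpa only [ofReal_norm, ENNReal.ofReal_ofNat] using h2

/-- Continuity of the expectation of a pointwise continuous family which is locally bounded
in `L²`. -/
theorem continuousAt_integral_of_lintegral_sq_le {α X E : Type*} [MeasurableSpace α]
    {ν : Measure α} [IsFiniteMeasure ν] [TopologicalSpace X] [FirstCountableTopology X]
    [NormedAddCommGroup E] [NormedSpace ℝ E] {F : X → α → E} {x₀ : X}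
    (hF : ∀ᶠ x in 𝓝 x₀, Integrable (F x) ν) (hcont : ∀ a, ContinuousAt (fun x => F x a) x₀)
    {C : ℝ≥0∞} (hC : C ≠ ∞) (hbound : ∀ᶠ x in 𝓝 x₀, ∫⁻ a, ‖F x a‖ₑ ^ 2 ∂ν ≤ C) :
    ContinuousAt (fun x => ∫ a, F x a ∂ν) x₀ := by
  have hF0 := hF.self_of_nhds
  have hB0 := hbound.self_of_nhds
  refine tendsto_integral_of_L1 _ hF0.1 hF ?_
  rw [ENNReal.tendsto_nhds_zero]
  intro ε hε
  -- Truncation level: below `R` dominated convergence applies, and the excess is at most the second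
  -- moment over `R`, uniformly near `x₀`.
  obtain ⟨R, hR0, hR, hRε⟩ : ∃ R : ℝ≥0∞, R ≠ 0 ∧ R ≠ ∞ ∧ (4 * C) / R ≤ ε / 2 := by
    by_cases hε' : ε = ∞
    · exact ⟨1, one_ne_zero, ENNReal.one_ne_top, by
        simp [hε', ENNReal.top_div_of_ne_top]⟩
    · have hε2 : ε / 2 ≠ 0 := (ENNReal.half_pos hε.ne').ne'
      have hε3 : ε / 2 ≠ ∞ := ENNReal.div_ne_top hε' two_ne_zero
      refine ⟨4 * C / (ε / 2) + 1, by simp, ?_, ?_⟩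
      · exact ENNReal.add_ne_top.2
          ⟨ENNReal.div_ne_top (ENNReal.mul_ne_top (by simp) hC) hε2, ENNReal.one_ne_top⟩
      · refine ENNReal.div_le_of_le_mul ?_
        rw [mul_add, ENNReal.mul_div_cancel hε2 hε3]
        exact le_self_add
  have hmin : Tendsto (fun x => ∫⁻ a, min ‖F x a - F x₀ a‖ₑ R ∂ν) (𝓝 x₀) (𝓝 0) := by
    have h0 : ∫⁻ _, (0 : ℝ≥0∞) ∂ν = 0 := lintegral_zero
    rw [← h0]
    refine tendsto_lintegral_filter_of_dominated_convergence' (fun _ => R) ?_ ?_ ?_ ?_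
    · filter_upwards [hF] with x hx
      exact (hx.1.sub hF0.1).enorm.min aemeasurable_const
    · exact Eventually.of_forall fun x => Eventually.of_forall fun a => min_le_right _ _
    · rw [lintegral_const]
      exact ENNReal.mul_ne_top hR (measure_ne_top _ _)
    · refine Eventually.of_forall fun a => ?_
      have h1 : Tendsto (fun x => ‖F x a - F x₀ a‖ₑ) (𝓝 x₀) (𝓝 0) := by
        have := ((hcont a).sub (continuousAt_const (y := F x₀ a))).tendsto.enorm
        simpa using this
      have := h1.min (tendsto_const_nhds (x := R))
      simpa using this
  have hsq : ∀ᶠ x in 𝓝 x₀, ∫⁻ a, ‖F x a - F x₀ a‖ₑ ^ 2 ∂ν ≤ 4 * C := by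
    filter_upwards [hbound, hF] with x hx hFx
    calc ∫⁻ a, ‖F x a - F x₀ a‖ₑ ^ 2 ∂ν
        ≤ ∫⁻ a, (2 * ‖F x a‖ₑ ^ 2 + 2 * ‖F x₀ a‖ₑ ^ 2) ∂ν :=
          lintegral_mono fun a => enorm_sub_sq_le _ _
      _ = 2 * ∫⁻ a, ‖F x a‖ₑ ^ 2 ∂ν + 2 * ∫⁻ a, ‖F x₀ a‖ₑ ^ 2 ∂ν := by
        rw [lintegral_add_left' ((hFx.1.enorm.pow_const 2).const_mul 2),
          lintegral_const_mul' _ _ (by simp), lintegral_const_mul' _ _ (by simp)]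
      _ ≤ 2 * C + 2 * C := by gcongr
      _ = 4 * C := by ring
  filter_upwards [(ENNReal.tendsto_nhds_zero.1 hmin) (ε / 2) (ENNReal.half_pos hε.ne'), hsq, hF]
    with x hx hx2 hFx
  calc ∫⁻ a, ‖F x a - F x₀ a‖ₑ ∂ν
      ≤ ∫⁻ a, (min ‖F x a - F x₀ a‖ₑ R + ‖F x a - F x₀ a‖ₑ ^ 2 / R) ∂ν :=
        lintegral_mono fun a => le_min_add_sq_div _ hR0 hR
    _ = ∫⁻ a, min ‖F x a - F x₀ a‖ₑ R ∂ν + (∫⁻ a, ‖F x a - F x₀ a‖ₑ ^ 2 ∂ν) / R := by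
        have hm : AEMeasurable (fun a => min ‖F x a - F x₀ a‖ₑ R) ν :=
          (hFx.1.sub hF0.1).enorm.min aemeasurable_const
        rw [lintegral_add_left' hm]
        simp_rw [div_eq_mul_inv]
        rw [lintegral_mul_const' _ _ (ENNReal.inv_ne_top.2 hR0)]
    _ ≤ ε / 2 + ε / 2 := add_le_add hx ((ENNReal.div_le_div_right hx2 R).trans hRε)
    _ = ε := ENNReal.add_halves ε

/-! ### Measurability and moments of the E-step, continuity of the mean field. -/

namespace LatentModel

variable {𝒳 𝒴 : Type*} [MeasurableSpace 𝒳] [MeasurableSpace 𝒴] {d m : ℕ}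
  {M : LatentModel 𝒳 𝒴 d m} {𝒮 : Set (EuclideanSpace ℝ (Fin d))} {p : 𝒴 → ℝ}

/-- On `𝒮` the E-step `(y, s) ↦ s̄(y; θ̄(s))` agrees with a jointly measurable function. -/
theorem exists_stronglyMeasurable_condStat (hM : M.IsLatentFamily)
    (hexp : M.ExponentialAssumption 𝒮) (hreg : M.RegularityAssumption 𝒮 p) :
    ∃ F : 𝒴 × EuclideanSpace ℝ (Fin d) → EuclideanSpace ℝ (Fin d), StronglyMeasurable F ∧
      ∀ y, ∀ s ∈ 𝒮, F (y, s) = M.condStat y (M.thetaBar s) := by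
  have := hM.isSFiniteKernel_fiber
  have hmaps : Set.MapsTo M.thetaBar 𝒮 M.Θ := fun s hs => (thetaBar_spec hexp hs).1
  have hψc : ContinuousOn (fun s => M.ψ (M.thetaBar s)) 𝒮 :=
    hreg.contDiffOn_ψ.continuousOn.comp hreg.contDiffOn_thetaBar.continuousOn hmaps
  have hφc : ContinuousOn M.phiBar 𝒮 := (contDiffOn_phiBar hexp hreg).continuousOn
  classical
  -- Outside `𝒮` nothing is known of θ̄, so its values there are replaced by a constant to obtain
  -- measurability.
  let a : EuclideanSpace ℝ (Fin d) → ℝ := 𝒮.piecewise (fun s => M.ψ (M.thetaBar s)) fun _ => 0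
  let b : EuclideanSpace ℝ (Fin d) → EuclideanSpace ℝ (Fin d) := 𝒮.piecewise M.phiBar fun _ => 0
  have ha : Measurable a :=
    hψc.measurable_piecewise continuousOn_const hexp.isOpen.measurableSet
  have hb : Measurable b :=
    hφc.measurable_piecewise continuousOn_const hexp.isOpen.measurableSet
  let q : (𝒴 × EuclideanSpace ℝ (Fin d)) × 𝒳 → ℝ := fun z =>
    M.h z.2 * Real.exp (-a z.1.2 + ⟪M.S z.2, b z.1.2⟫)
  have hS : Measurable fun z : (𝒴 × EuclideanSpace ℝ (Fin d)) × 𝒳 => M.S z.2 :=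
    hM.measurable_S.comp measurable_snd
  have hq : Measurable q :=
    (hM.measurable_h.comp measurable_snd).mul
      (((ha.comp (measurable_snd.comp measurable_fst)).neg.add
        (hS.inner (hb.comp (measurable_snd.comp measurable_fst)))).exp)
  let κ : Kernel (𝒴 × EuclideanSpace ℝ (Fin d)) 𝒳 := Kernel.prodMkRight _ M.fiber
  have h1 : StronglyMeasurable fun z => ∫ x, q (z, x) ∂(κ z) :=
    hq.stronglyMeasurable.integral_kernel_prod_right'
  have h2 : StronglyMeasurable fun z => ∫ x, q (z, x) • M.S x ∂(κ z) :=
    (hq.smul hS).stronglyMeasurable.integral_kernel_prod_right'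
  refine ⟨fun z => (∫ x, q (z, x) ∂(κ z))⁻¹ • ∫ x, q (z, x) • M.S x ∂(κ z),
    h1.measurable.inv.stronglyMeasurable.smul h2, fun y s hs => ?_⟩
  have hqf : ∀ x, q ((y, s), x) = M.f x (M.thetaBar s) := fun x => by
    simp only [q, a, b, f, Set.piecewise_eq_of_mem _ _ _ hs, phiBar]
  simp only [hqf, condStat, g, κ, Kernel.prodMkRight_apply]

/-- For `q > 2`, `a ^ 2 ≤ 1 + a ^ q`, and the law has mass 1. -/
theorem exists_lintegral_sq_le (hp : M.IsObsDensity p) (hreg : M.RegularityAssumption 𝒮 p)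
    {K : Set (EuclideanSpace ℝ (Fin d))} (hK : IsCompact K) (hK𝒮 : K ⊆ 𝒮) :
    ∃ C : ℝ≥0∞, C ≠ ∞ ∧
      ∀ s ∈ K, ∫⁻ y, ‖M.condStat y (M.thetaBar s)‖ₑ ^ 2 ∂(M.obsLaw p) ≤ C := by
  have := isProbabilityMeasure_obsLaw hp
  obtain ⟨q, hq, hsup⟩ := hreg.moment
  refine ⟨_, ENNReal.add_ne_top.2 ⟨ENNReal.one_ne_top, (hsup K hK𝒮 hK).ne⟩, fun s hs => ?_⟩
  have hpt : ∀ a : ℝ≥0∞, a ^ 2 ≤ 1 + a ^ q := fun a => by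
    rcases le_total a 1 with h | h
    · exact (pow_le_one₀ zero_le h).trans le_self_add
    · refine le_trans ?_ le_add_self
      rw [← ENNReal.rpow_two]
      exact ENNReal.rpow_le_rpow_of_exponent_le h hq.le
  refine (lintegral_mono fun y => hpt _).trans ?_
  rw [lintegral_add_left measurable_const, lintegral_one, measure_univ]
  gcongr
  exact le_iSup₂ (f := fun s (_ : s ∈ K) =>
    ∫⁻ y, ‖M.condStat y (M.thetaBar s)‖ₑ ^ q ∂(M.obsLaw p)) s hs

theorem integrable_condStat (hM : M.IsLatentFamily) (hp : M.IsObsDensity p)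
    (hexp : M.ExponentialAssumption 𝒮) (hreg : M.RegularityAssumption 𝒮 p)
    {s : EuclideanSpace ℝ (Fin d)} (hs : s ∈ 𝒮) :
    Integrable (fun y => M.condStat y (M.thetaBar s)) (M.obsLaw p) := by
  have := isProbabilityMeasure_obsLaw hp
  obtain ⟨F, hF, hFeq⟩ := exists_stronglyMeasurable_condStat hM hexp hreg
  obtain ⟨C, hC, hCK⟩ := exists_lintegral_sq_le hp hreg (isCompact_singleton (x := s))
    (Set.singleton_subset_iff.2 hs)
  have hmeas : AEStronglyMeasurable (fun y => M.condStat y (M.thetaBar s)) (M.obsLaw p) := by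
    simp_rw [← hFeq _ s hs]
    exact (hF.comp_measurable (measurable_id.prodMk measurable_const)).aestronglyMeasurable
  have hL2 : MemLp (fun y => M.condStat y (M.thetaBar s)) 2 (M.obsLaw p) := by
    refine ⟨hmeas, (eLpNorm_lt_top_iff_lintegral_rpow_enorm_lt_top two_ne_zero
      ENNReal.ofNat_ne_top).2 ?_⟩
    simp only [ENNReal.toReal_ofNat, ENNReal.rpow_two]
    exact (hCK s rfl).trans_lt hC.lt_top
  exact hL2.integrable one_le_two

theorem continuousOn_integral_condStat (hM : M.IsLatentFamily) (hp : M.IsObsDensity p)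
    (hexp : M.ExponentialAssumption 𝒮) (hreg : M.RegularityAssumption 𝒮 p)
    (hobs : M.ObservedRegularity p) :
    ContinuousOn (fun s => ∫ y, M.condStat y (M.thetaBar s) ∂(M.obsLaw p)) 𝒮 := by
  have := isProbabilityMeasure_obsLaw hp
  intro s hs
  refine ContinuousAt.continuousWithinAt ?_
  obtain ⟨K, hK, hsK, hK𝒮⟩ := exists_compact_subset hexp.isOpen hs
  obtain ⟨C, hC, hCK⟩ := exists_lintegral_sq_le hp hreg hK hK𝒮
  have hKn : K ∈ 𝓝 s := mem_interior_iff_mem_nhds.1 hsK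
  refine continuousAt_integral_of_lintegral_sq_le (C := C) ?_ ?_ hC ?_
  · exact Eventually.mono hKn fun t ht => integrable_condStat hM hp hexp hreg (hK𝒮 ht)
  · intro y
    have hθ := (thetaBar_spec hexp hs).1
    exact ((hobs.continuousOn_condStat y).continuousAt (hreg.isOpen.mem_nhds hθ)).comp
      (f := M.thetaBar)
      (hreg.contDiffOn_thetaBar.continuousOn.continuousAt (hexp.isOpen.mem_nhds hs))
  · exact Eventually.mono hKn hCK

theorem continuousOn_meanField (hM : M.IsLatentFamily) (hp : M.IsObsDensity p)
    (hexp : M.ExponentialAssumption 𝒮) (hreg : M.RegularityAssumption 𝒮 p)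
    (hobs : M.ObservedRegularity p) : ContinuousOn (M.meanField p) 𝒮 :=
  (continuousOn_integral_condStat hM hp hexp hreg hobs).sub continuousOn_id

/-- A Robbins-Monro recursion driven by the mean field, with vanishing perturbation, which stays
in a compact subset of `𝒮` converges to the roots of the mean field. -/
theorem tendsto_meanField_of_recursion (hM : M.IsLatentFamily) (hp : M.IsObsDensity p)
    (hexp : M.ExponentialAssumption 𝒮) (hreg : M.RegularityAssumption 𝒮 p)
    (hobs : M.ObservedRegularity p) (hw : IsNowhereDense (M.lyapunov p '' M.roots 𝒮 p))
    {K : Set (EuclideanSpace ℝ (Fin d))} (hK : IsCompact K) (hK𝒮 : K ⊆ 𝒮)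
    {γ : ℕ → ℝ} (hγ : ∀ n, 0 < γ n ∧ γ n < 1) (hγ0 : Tendsto γ atTop (𝓝 0))
    (hsum : Tendsto (fun n => ∑ k ∈ Finset.range n, γ k) atTop atTop)
    {x e : ℕ → EuclideanSpace ℝ (Fin d)} (hx : ∀ n, x n ∈ K) (he : Tendsto e atTop (𝓝 0))
    (hrec : ∀ n, x (n + 1) = x n + γ n • (M.meanField p (x n) + e n)) :
    Tendsto (fun n => M.meanField p (x n)) atTop (𝓝 0) := by
  have hh := continuousOn_meanField hM hp hexp hreg hobs
  have hη' : ContinuousOn (fderiv ℝ M.phiBar) 𝒮 :=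
    (contDiffOn_phiBar hexp hreg).continuousOn_fderiv_of_isOpen hexp.isOpen le_rfl
  -- The abstract result with w the divergence at θ̄(s) and η = φ ∘ θ̄.
  refine tendsto_meanField_zero hexp.isOpen hK hK𝒮 hh
    (fun s hs => hasFDerivAt_lyapunov hM hp hexp hreg hobs hs
      (integrable_condStat hM hp hexp hreg hs))
    ((((innerSL ℝ).continuous.comp_continuousOn hh).clm_comp hη').neg)
    (fun s hs => hasFDerivAt_phiBar hexp hreg hs) hη' (fun s hs => ?_) (fun s hs h0 => ?_)
    (fun s hs t ht hst => ?_) hw hγ hγ0 hsum hx he hrec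
  · have := inner_fderiv_phiBar_nonneg hexp hreg hs (M.meanField p s)
    rw [real_inner_comm] at this
    simpa using this
  · refine fderiv_phiBar_eq_zero hexp hreg hs ?_
    rw [real_inner_comm]
    simpa using h0
  · have h1 := condStat_eq_of_phi_eq hM (thetaBar_spec hexp hs).1 (thetaBar_spec hexp ht).1 hst
    simp only [meanField, h1, add_sub_cancel]

end LatentModel

/-! ### Convergence of the weighted martingale noise. -/

section Noise

variable {Ω A B : Type*} {m0 : MeasurableSpace Ω} {P : Measure Ω} [IsProbabilityMeasure P]
  [MeasurableSpace A] [MeasurableSpace B]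

/-- Convergence of `L²`-bounded martingales, in terms of their increments. -/
theorem ae_exists_tendsto_sum_of_condExp_eq_zero {ℱ : Filtration ℕ m0} {D : ℕ → Ω → ℝ}
    (hD : ∀ n, StronglyMeasurable[ℱ (n + 1)] (D n)) (hL2 : ∀ n, MemLp (D n) 2 P)
    (hcond : ∀ n, P[D n | ℱ n] =ᵐ[P] 0) {c : ℕ → ℝ} (hc : Summable c)
    (hbound : ∀ n, ∫ ω, D n ω ^ 2 ∂P ≤ c n) :
    ∀ᵐ ω ∂P, ∃ l, Tendsto (fun n => ∑ k ∈ Finset.range n, D k ω) atTop (𝓝 l) := by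
  set S : ℕ → Ω → ℝ := fun n ω => ∑ k ∈ Finset.range n, D k ω with hS
  have hSsucc : ∀ n, S (n + 1) = S n + D n := fun n => by
    ext ω; simp [hS, Finset.sum_range_succ]
  have hSL2 : ∀ n, MemLp (S n) 2 P := fun n => memLp_finsetSum _ fun k _ => hL2 k
  have hSadp : StronglyAdapted ℱ S := fun n => by
    refine Finset.stronglyMeasurable_fun_sum _ fun k hk => ?_
    exact (hD k).mono (ℱ.mono (Finset.mem_range.1 hk))
  have hSint : ∀ n, Integrable (S n) P := fun n => (hSL2 n).integrable one_le_two
  have hmart : Martingale S ℱ P := by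
    refine martingale_of_condExp_sub_eq_zero_nat hSadp hSint fun n => ?_
    rw [hSsucc, add_sub_cancel_left]
    exact hcond n
  -- Increments are orthogonal to the past, so second moments add up.
  have hcross : ∀ n, ∫ ω, S n ω * D n ω ∂P = 0 := fun n => by
    have hmul : Integrable (S n * D n) P := (hSL2 n).integrable_mul (hL2 n)
    have h1 := condExp_mul_of_stronglyMeasurable_left (hSadp n) hmul
      ((hL2 n).integrable one_le_two)
    have h2 : P[S n * D n | ℱ n] =ᵐ[P] 0 := by
      filter_upwards [h1, hcond n] with ω h1 h2
      rw [h1, Pi.mul_apply, h2]; simp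
    change ∫ ω, (S n * D n) ω ∂P = 0
    rw [← integral_condExp (ℱ.le n), integral_congr_ae h2]
    simp
  have hc0 : ∀ n, 0 ≤ c n := fun n => (integral_nonneg fun ω => sq_nonneg _).trans (hbound n)
  have hsq : ∀ n, ∫ ω, S n ω ^ 2 ∂P ≤ ∑ k ∈ Finset.range n, c k := by
    intro n
    induction n with
    | zero => simp [hS]
    | succ n ih =>
      have hmul : Integrable (fun ω => S n ω * D n ω) P := (hSL2 n).integrable_mul (hL2 n)
      have heq : ∀ ω, S (n + 1) ω ^ 2 = S n ω ^ 2 + 2 * (S n ω * D n ω) + D n ω ^ 2 := fun ω => by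
        rw [hSsucc, Pi.add_apply]; ring
      have hadd : Integrable (fun ω => S n ω ^ 2 + 2 * (S n ω * D n ω)) P :=
        (hSL2 n).integrable_sq.add (hmul.const_mul 2)
      simp_rw [heq]
      rw [integral_add hadd (hL2 n).integrable_sq,
        integral_add (hSL2 n).integrable_sq (hmul.const_mul 2), integral_const_mul, hcross,
        Finset.sum_range_succ]
      linarith [hbound n]
  have hL1 : ∀ n, eLpNorm (S n) 1 P ≤ (1 + ∑' k, c k).toNNReal := fun n => by
    rw [eLpNorm_one_eq_lintegral_enorm, ← ofReal_integral_norm_eq_lintegral_enorm (hSint n)]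
    refine ENNReal.ofReal_le_ofReal ?_
    have h1 : ∫ ω, ‖S n ω‖ ∂P ≤ ∫ ω, (1 + S n ω ^ 2) ∂P := by
      refine integral_mono (hSint n).norm ((integrable_const _).add (hSL2 n).integrable_sq)
        fun ω => ?_
      simp only [Real.norm_eq_abs]
      nlinarith [sq_abs (S n ω), sq_nonneg (|S n ω| - 1), abs_nonneg (S n ω)]
    rw [integral_add (integrable_const _) (hSL2 n).integrable_sq] at h1
    simp only [integral_const, probReal_univ, one_smul] at h1
    linarith [hsq n, hc.sum_le_tsum (Finset.range n) fun k _ => hc0 k]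
  exact hmart.submartingale.exists_ae_tendsto_of_bdd hL1

/-- The indicator of a test event is joined to `X` in one variable independent of `Y`; Fubini then
integrates over `Y` first. -/
theorem condExp_comp_prodMk_eq_zero {Ω : Type*} {m m0 : MeasurableSpace Ω} {P : Measure Ω}
    [IsProbabilityMeasure P] (hm : m ≤ m0) {X : Ω → A}
    (hX : Measurable[m] X) {Y : Ω → B} (hY : Measurable Y)
    (hind : Indep m (MeasurableSpace.comap Y inferInstance) P) {G : A × B → ℝ}
    (hG : Measurable G) (hint : Integrable (fun ω => G (X ω, Y ω)) P)
    (hzero : ∀ a, ∫ b, G (a, b) ∂(P.map Y) = 0) :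
    P[fun ω => G (X ω, Y ω) | m] =ᵐ[P] 0 := by
  have := Measure.isProbabilityMeasure_map (μ := P) hY.aemeasurable
  refine (ae_eq_condExp_of_forall_setIntegral_eq hm hint (fun _ _ _ => integrableOn_zero)
    (fun s hs _ => ?_) stronglyMeasurable_zero.aestronglyMeasurable).symm
  let Z : Ω → ℝ × A := fun ω => (s.indicator 1 ω, X ω)
  have hs1 : Measurable[m] (s.indicator (1 : Ω → ℝ)) :=
    Measurable.indicator (m := m) measurable_const hs
  have hZ : Measurable[m] Z := hs1.prodMk hX
  have hZ0 : Measurable Z := hZ.mono hm le_rfl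
  have hZY : IndepFun Z Y P := by
    rw [IndepFun_iff_Indep]
    exact indep_of_indep_of_le_left hind hZ.comap_le
  let Q : (ℝ × A) × B → ℝ := fun z => z.1.1 * G (z.1.2, z.2)
  have hQ : Measurable Q := by fun_prop
  have hQeq : (fun ω => Q (Z ω, Y ω)) = s.indicator fun ω => G (X ω, Y ω) := by
    ext ω
    by_cases hω : ω ∈ s <;> simp [Q, Z, hω]
  have hs0 : MeasurableSet s := hm s hs
  have hQint : Integrable Q ((P.map Z).prod (P.map Y)) := by
    rw [← hZY.map_prod_eq_prod_map_map hZ0.aemeasurable hY.aemeasurable,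
      integrable_map_measure hQ.aestronglyMeasurable (hZ0.prodMk hY).aemeasurable]
    exact (integrable_indicator_iff hs0).2 hint.integrableOn |>.congr (by rw [← hQeq]; rfl)
  have h1 : ∫ ω in s, G (X ω, Y ω) ∂P = ∫ z, Q z ∂((P.map Z).prod (P.map Y)) := by
    rw [← hZY.map_prod_eq_prod_map_map hZ0.aemeasurable hY.aemeasurable,
      integral_map (hZ0.prodMk hY).aemeasurable hQ.aestronglyMeasurable, hQeq,
      integral_indicator hs0]
  have h2 : ∀ z : ℝ × A, ∫ b, Q (z, b) ∂(P.map Y) = 0 := fun z => by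
    simp only [Q, integral_const_mul, hzero, mul_zero]
  rw [h1, integral_prod _ hQint]
  simp [h2]

/-- Almost sure convergence of a weighted sum of centred noise terms `G (X k, Y k)`, where `X k`
is known before the fresh observation `Y k`. -/
theorem ae_exists_tendsto_sum_mul_comp {ℱ : Filtration ℕ m0} {X : ℕ → Ω → A} {Y : ℕ → Ω → B}
    (hX : ∀ n, Measurable[ℱ n] (X n)) (hY : ∀ n, Measurable[ℱ (n + 1)] (Y n))
    (hind : ∀ n, Indep (ℱ n) (MeasurableSpace.comap (Y n) inferInstance) P)
    {ν : Measure B} (hν : ∀ n, P.map (Y n) = ν) {G : A × B → ℝ} (hG : Measurable G)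
    (hzero : ∀ a, ∫ b, G (a, b) ∂ν = 0) {C : ℝ≥0∞} (hC : C ≠ ∞)
    (hbound : ∀ a, ∫⁻ b, ‖G (a, b)‖ₑ ^ 2 ∂ν ≤ C) {γ : ℕ → ℝ}
    (hγ : Summable fun n => γ n ^ 2) :
    ∀ᵐ ω ∂P, ∃ l, Tendsto (fun n => ∑ k ∈ Finset.range n, γ k * G (X k ω, Y k ω)) atTop (𝓝 l) := by
  have hX0 : ∀ n, Measurable (X n) := fun n => (hX n).mono (ℱ.le n) le_rfl
  have hY0 : ∀ n, Measurable (Y n) := fun n => (hY n).mono (ℱ.le _) le_rfl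
  have hXY : ∀ n, Measurable fun ω => G (X n ω, Y n ω) := fun n =>
    hG.comp ((hX0 n).prodMk (hY0 n))
  have hlin : ∀ n, ∫⁻ ω, ‖G (X n ω, Y n ω)‖ₑ ^ 2 ∂P ≤ C := fun n => by
    have h1 := Measure.isProbabilityMeasure_map (μ := P) (hY0 n).aemeasurable
    have h2 := Measure.isProbabilityMeasure_map (μ := P) (hX0 n).aemeasurable
    have hXYind : IndepFun (X n) (Y n) P := by
      rw [IndepFun_iff_Indep]
      exact indep_of_indep_of_le_left (hind n) (hX n).comap_le
    have hGm : Measurable fun z => ‖G z‖ₑ ^ 2 := hG.enorm.pow_const 2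
    rw [← lintegral_map hGm ((hX0 n).prodMk (hY0 n)),
      hXYind.map_prod_eq_prod_map_map (hX0 n).aemeasurable (hY0 n).aemeasurable,
      lintegral_prod _ hGm.aemeasurable, hν]
    refine (lintegral_mono hbound).trans ?_
    rw [lintegral_const, measure_univ, mul_one]
  have hL2 : ∀ n, MemLp (fun ω => G (X n ω, Y n ω)) 2 P := fun n => by
    refine ⟨(hXY n).aestronglyMeasurable, (eLpNorm_lt_top_iff_lintegral_rpow_enorm_lt_top
      two_ne_zero ENNReal.ofNat_ne_top).2 ?_⟩
    simp only [ENNReal.toReal_ofNat, ENNReal.rpow_two]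
    exact (hlin n).trans_lt hC.lt_top
  have hsq : ∀ n, ∫ ω, G (X n ω, Y n ω) ^ 2 ∂P ≤ C.toReal := fun n => by
    rw [integral_eq_lintegral_of_nonneg_ae (Eventually.of_forall fun ω => sq_nonneg _)
      ((hXY n).pow_const 2).aestronglyMeasurable]
    refine ENNReal.toReal_mono hC (le_trans (le_of_eq ?_) (hlin n))
    refine lintegral_congr fun ω => ?_
    rw [← sq_abs, ENNReal.ofReal_pow (abs_nonneg _), ← Real.norm_eq_abs, ofReal_norm]
  refine ae_exists_tendsto_sum_of_condExp_eq_zero (ℱ := ℱ) (fun n => ?_)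
    (fun n => (hL2 n).const_mul (γ n)) (fun n => ?_) (hγ.mul_right C.toReal) (fun n => ?_)
  · exact ((hG.comp (((hX n).mono (ℱ.mono n.le_succ) le_rfl).prodMk (hY n))).const_mul
      _).stronglyMeasurable
  · refine condExp_comp_prodMk_eq_zero (ℱ.le n) (hX n) (hY0 n) (hind n)
      (G := fun z => γ n * G z) (hG.const_mul _)
      (((hL2 n).integrable one_le_two).const_mul _) fun a => ?_
    rw [integral_const_mul, hν, hzero, mul_zero]
  · simp_rw [mul_pow]
    rw [integral_const_mul]
    exact mul_le_mul_of_nonneg_left (hsq n) (sq_nonneg _)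

/-- The law of `(X, (past, Y n))` is a product of three factors; reassociating it groups `X` with
the past. -/
theorem indepFun_prodMk_fin {Y : ℕ → Ω → B} (hY : ∀ n, Measurable (Y n)) (hYind : iIndepFun Y P)
    {X : Ω → A} (hX : Measurable X) (hXind : IndepFun X (fun ω n => Y n ω) P) (n : ℕ) :
    IndepFun (fun ω => (X ω, fun i : Fin n => Y i ω)) (Y n) P := by
  let T : Ω → Fin n → B := fun ω i => Y i ω
  have hT : Measurable T := measurable_pi_lambda _ fun i => hY i
  have hXTU : IndepFun X (fun ω => (T ω, Y n ω)) P :=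
    hXind.comp (φ := id) (ψ := fun y : ℕ → B => ((fun i : Fin n => y i), y n)) measurable_id
      ((measurable_pi_lambda _ fun i => measurable_pi_apply _).prodMk (measurable_pi_apply _))
  have hXT : IndepFun X T P := hXTU.comp (φ := id) measurable_id measurable_fst
  have hTU : IndepFun T (Y n) P := by
    have h := hYind.indepFun_finset (Finset.range n) {n} (by simp) hY
    exact h.comp
      (φ := fun (y : (Finset.range n) → B) (i : Fin n) => y ⟨i, Finset.mem_range.2 i.2⟩)
      (ψ := fun (y : ({n} : Finset ℕ) → B) => y ⟨n, Finset.mem_singleton_self n⟩)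
      (measurable_pi_lambda _ fun i => measurable_pi_apply _) (measurable_pi_apply _)
  have := Measure.isProbabilityMeasure_map (μ := P) (hY n).aemeasurable
  have := Measure.isProbabilityMeasure_map (μ := P) hX.aemeasurable
  have := Measure.isProbabilityMeasure_map (μ := P) hT.aemeasurable
  rw [indepFun_iff_map_prod_eq_prod_map_map (hX.prodMk hT).aemeasurable (hY n).aemeasurable,
    hXT.map_prod_eq_prod_map_map hX.aemeasurable hT.aemeasurable]
  have h := hXTU.map_prod_eq_prod_map_map hX.aemeasurable (hT.prodMk (hY n)).aemeasurable
  rw [hTU.map_prod_eq_prod_map_map hT.aemeasurable (hY n).aemeasurable,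
    ← Measure.prodAssoc_prod] at h
  have h' := congrArg (Measure.map MeasurableEquiv.prodAssoc.symm) h
  rw [MeasurableEquiv.map_symm_map,
    Measure.map_map MeasurableEquiv.prodAssoc.symm.measurable
      (hX.prodMk (hT.prodMk (hY n)))] at h'
  exact h'

/-- The filtration generated by `X` and the first `n` observations `Y 0, …, Y (n - 1)`. -/
def historyFiltration {X : Ω → A} (hX : Measurable X) {Y : ℕ → Ω → B} (hY : ∀ n, Measurable (Y n)) :
    Filtration ℕ m0 where
  seq n := MeasurableSpace.comap (fun ω => (X ω, fun i : Fin n => Y i ω)) inferInstance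
  mono' i j hij := by
    let r : A × (Fin j → B) → A × (Fin i → B) := fun z => (z.1, fun k => z.2 (Fin.castLE hij k))
    have hr : Measurable r := measurable_fst.prodMk
      (measurable_pi_lambda _ fun k => (measurable_pi_apply _).comp measurable_snd)
    have h := hr.comp (comap_measurable fun ω => (X ω, fun i : Fin j => Y i ω))
    exact h.comap_le
  le' n := (hX.prodMk (measurable_pi_lambda (fun ω (i : Fin n) => Y i ω) fun i =>
    hY i)).comap_le

variable {X : Ω → A} (hX : Measurable X) {Y : ℕ → Ω → B} (hY : ∀ n, Measurable (Y n))

theorem measurable_historyFiltration_init (n : ℕ) : Measurable[historyFiltration hX hY n] X :=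
  measurable_fst.comp (comap_measurable fun ω => (X ω, fun i : Fin n => Y i ω))

theorem measurable_historyFiltration_obs (n : ℕ) :
    Measurable[historyFiltration hX hY (n + 1)] (Y n) :=
  ((measurable_pi_apply (Fin.last n)).comp measurable_snd).comp
    (comap_measurable fun ω => (X ω, fun i : Fin (n + 1) => Y i ω))

theorem indep_historyFiltration (hYind : iIndepFun Y P)
    (hXind : IndepFun X (fun ω n => Y n ω) P) (n : ℕ) :
    Indep (historyFiltration hX hY n) (MeasurableSpace.comap (Y n) inferInstance) P :=
  (IndepFun_iff_Indep _ _ _).1 (indepFun_prodMk_fin hY hYind hX hXind n)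

end Noise

/-! ### Distances to limit sets and exhaustion by compact sets. -/

theorem tendsto_infEDist_of_tendsto_zero {E F G : Type*} [PseudoMetricSpace E]
    [PseudoEMetricSpace F] [TopologicalSpace G] [T2Space G] [Zero G] {K : Set E} (hK : IsCompact K)
    {h : E → G} (hh : ContinuousOn h K) {τ : E → F} (hτ : ContinuousOn τ K) {L : Set F}
    (hL : ∀ s ∈ K, h s = 0 → τ s ∈ L) {s : ℕ → E} (hs : ∀ᶠ n in atTop, s n ∈ K)
    (hlim : Tendsto (fun n => h (s n)) atTop (𝓝 0)) :
    Tendsto (fun n => Metric.infEDist (τ (s n)) L) atTop (𝓝 0) := by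
  refine tendsto_of_subseq_tendsto fun ns hns => ?_
  have hsK := hns.eventually hs
  -- A limit point `a` is a zero of `h`, so `τ a ∈ L` and the distance to `L` is at most the
  -- distance to `τ a`.
  obtain ⟨a, haK, φ, hφ, ha⟩ := hK.tendsto_subseq' hsK.frequently
  have hsub : Tendsto (fun n => ns (φ n)) atTop atTop := hns.comp hφ.tendsto_atTop
  have ha' : Tendsto (fun n => s (ns (φ n))) atTop (𝓝[K] a) :=
    tendsto_nhdsWithin_iff.2 ⟨ha, hsub.eventually hs⟩
  have h0 : h a = 0 := tendsto_nhds_unique ((hh a haK).tendsto.comp ha') (hlim.comp hsub)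
  refine ⟨φ, ?_⟩
  have h1 : Tendsto (fun n => edist (τ (s (ns (φ n)))) (τ a)) atTop (𝓝 0) :=
    tendsto_iff_edist_tendsto_0.1 ((hτ a haK).tendsto.comp ha')
  exact tendsto_of_tendsto_of_tendsto_of_le_of_le tendsto_const_nhds h1 (fun _ => zero_le)
    fun n => Metric.infEDist_le_edist_of_mem (hL a haK h0)

/-- The points of norm at most `k` at distance at least `1 / (k + 1)` from the complement
of `S`. -/
def exhaustion {E : Type*} [NormedAddCommGroup E] (S : Set E) (k : ℕ) : Set E :=
  {x | ‖x‖ ≤ k} ∩ {x | ((k : ℝ≥0∞) + 1)⁻¹ ≤ Metric.infEDist x Sᶜ}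

section Exhaustion

variable {E : Type*} [NormedAddCommGroup E]

theorem isClosed_exhaustion (S : Set E) (k : ℕ) : IsClosed (exhaustion S k) :=
  (isClosed_le continuous_norm continuous_const).inter
    (isClosed_le continuous_const Metric.continuous_infEDist)

theorem isCompact_exhaustion [ProperSpace E] (S : Set E) (k : ℕ) : IsCompact (exhaustion S k) :=
  (isCompact_closedBall (0 : E) k).of_isClosed_subset (isClosed_exhaustion S k)
    fun x hx => by simpa using hx.1

theorem exhaustion_subset (S : Set E) (k : ℕ) : exhaustion S k ⊆ S := by
  intro x hx
  by_contra hxS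
  have h : ((k : ℝ≥0∞) + 1)⁻¹ ≤ Metric.infEDist x Sᶜ := hx.2
  rw [Metric.infEDist_zero_of_mem (Set.mem_compl hxS), nonpos_iff_eq_zero, ENNReal.inv_eq_zero] at h
  exact ENNReal.add_ne_top.2 ⟨ENNReal.natCast_ne_top k, ENNReal.one_ne_top⟩ h

/-- Stability confines each path to one of countably many compact sets, so the noise need only be
treated on each of them. -/
theorem exists_eventually_mem_exhaustion {S : Set E} {s : ℕ → E}
    (hbdd : limsup (fun n => ‖s n‖ₑ) atTop < ⊤)
    (hdist : 0 < liminf (fun n => Metric.infEDist (s n) Sᶜ) atTop) :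
    ∃ k, ∀ᶠ n in atTop, s n ∈ exhaustion S k := by
  obtain ⟨k₁, hk₁⟩ := ENNReal.exists_nat_gt hbdd.ne
  obtain ⟨k₂, hk₂⟩ := ENNReal.exists_inv_nat_lt hdist.ne'
  refine ⟨max k₁ k₂, ?_⟩
  filter_upwards [eventually_lt_of_limsup_lt hk₁, eventually_lt_of_lt_liminf hk₂] with n h1 h2
  refine ⟨?_, le_trans (ENNReal.inv_le_inv.2 ?_) h2.le⟩
  · have h3 : ‖s n‖ₑ ≤ ((max k₁ k₂ : ℕ) : ℝ≥0∞) :=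
      h1.le.trans (Nat.cast_le.2 (le_max_left _ _))
    rw [← ofReal_norm, ← ENNReal.ofReal_natCast] at h3
    exact (ENNReal.ofReal_le_ofReal_iff (Nat.cast_nonneg _)).1 h3
  · have h4 : (k₂ : ℝ≥0∞) ≤ ((max k₁ k₂ : ℕ) : ℝ≥0∞) := Nat.cast_le.2 (le_max_right _ _)
    exact h4.trans le_self_add

end Exhaustion

/-! ### Almost sure convergence of online EM. -/

namespace LatentModel

variable {𝒳 𝒴 : Type*} [MeasurableSpace 𝒳] [MeasurableSpace 𝒴] {d m : ℕ}
  {M : LatentModel 𝒳 𝒴 d m} {𝒮 : Set (EuclideanSpace ℝ (Fin d))} {p : 𝒴 → ℝ}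

theorem tendsto_meanField_of_noise (hM : M.IsLatentFamily) (hp : M.IsObsDensity p)
    (hexp : M.ExponentialAssumption 𝒮) (hreg : M.RegularityAssumption 𝒮 p)
    (hobs : M.ObservedRegularity p) (hw : IsNowhereDense (M.lyapunov p '' M.roots 𝒮 p))
    {K : Set (EuclideanSpace ℝ (Fin d))} (hK : IsCompact K) (hK𝒮 : K ⊆ 𝒮)
    {γ : ℕ → ℝ} (hγ : ∀ n, 0 < γ n ∧ γ n < 1) (hγ0 : Tendsto γ atTop (𝓝 0))
    (hsum : Tendsto (fun n => ∑ k ∈ Finset.range n, γ k) atTop atTop)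
    {s ξ : ℕ → EuclideanSpace ℝ (Fin d)} (hs : ∀ᶠ n in atTop, s n ∈ K)
    (hrec : ∀ n, s (n + 1) = s n + γ n • (M.meanField p (s n) + ξ n))
    {l : EuclideanSpace ℝ (Fin d)}
    (hξ : Tendsto (fun n => ∑ k ∈ Finset.range n, γ k • ξ k) atTop (𝓝 l)) :
    Tendsto (fun n => M.meanField p (s n)) atTop (𝓝 0) := by
  have hh := continuousOn_meanField hM hp hexp hreg hobs
  obtain ⟨δ, hδ, hδ𝒮⟩ := hK.exists_cthickening_subset_open hexp.isOpen hK𝒮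
  set K' := Metric.cthickening δ K
  have hK' : IsCompact K' := hK.cthickening
  -- Adding the tail of the noise series cancels `ξ n` in the recursion, leaving a change of mean
  -- field that tends to zero. The shifted points may leave `K`, hence the thickening.
  let x : ℕ → EuclideanSpace ℝ (Fin d) := fun n =>
    s n + (l - ∑ k ∈ Finset.range n, γ k • ξ k)
  have hxs : Tendsto (fun n => dist (s n) (x n)) atTop (𝓝 0) := by
    have h1 : Tendsto (fun n => l - ∑ k ∈ Finset.range n, γ k • ξ k) atTop (𝓝 0) := by
      simpa using (tendsto_const_nhds (x := l)).sub hξ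
    have h2 := h1.norm
    rw [norm_zero] at h2
    refine h2.congr fun n => ?_
    rw [dist_eq_norm', add_sub_cancel_left]
  have hsK' : ∀ᶠ n in atTop, s n ∈ K' := hs.mono fun n hn => Metric.self_subset_cthickening K hn
  have hxK' : ∀ᶠ n in atTop, x n ∈ K' := by
    filter_upwards [hs, hxs.eventually (gt_mem_nhds hδ)] with n hn hlt
    exact Metric.mem_cthickening_of_dist_le (x n) (s n) δ K hn (by rw [dist_comm]; exact hlt.le)
  let e : ℕ → EuclideanSpace ℝ (Fin d) := fun n => M.meanField p (s n) - M.meanField p (x n)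
  have he : Tendsto e atTop (𝓝 0) := by
    have huc := hK'.uniformContinuousOn_of_continuous (hh.mono hδ𝒮)
    rw [Metric.uniformContinuousOn_iff] at huc
    rw [Metric.tendsto_nhds]
    intro ε hε
    obtain ⟨r, hr, hru⟩ := huc ε hε
    filter_upwards [hsK', hxK', hxs.eventually (gt_mem_nhds hr)] with n h1 h2 h3
    rw [dist_zero_right, ← dist_eq_norm]
    exact hru _ h1 _ h2 h3
  have hxrec : ∀ n, x (n + 1) = x n + γ n • (M.meanField p (x n) + e n) := fun n => by
    simp only [x, e, hrec, Finset.sum_range_succ, add_sub_cancel, smul_add]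
    abel
  obtain ⟨N, hN⟩ := eventually_atTop.1 hxK'
  have hshift : Tendsto (fun n => ∑ k ∈ Finset.range n, γ (k + N)) atTop atTop := by
    refine ((tendsto_add_atTop_iff_nat N).2 (tendsto_sum_Ico_atTop hsum N)).congr fun n => ?_
    rw [Finset.sum_Ico_eq_sum_range, Nat.add_sub_cancel]
    simp_rw [add_comm N]
  have hx := tendsto_meanField_of_recursion hM hp hexp hreg hobs hw hK' hδ𝒮
    (γ := fun n => γ (n + N)) (fun n => hγ _) ((tendsto_add_atTop_iff_nat N).2 hγ0) hshift
    (x := fun n => x (n + N)) (e := fun n => e (n + N)) (fun n => hN _ (by omega))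
    ((tendsto_add_atTop_iff_nat N).2 he)
    (fun n => by rw [← hxrec (n + N), add_right_comm])
  have hx' : Tendsto (fun n => M.meanField p (x n)) atTop (𝓝 0) :=
    (tendsto_add_atTop_iff_nat (f := fun n => M.meanField p (x n)) N).1 hx
  have := hx'.add he
  simpa [e] using this

theorem mem_stationaryPoints_of_mem_roots (hM : M.IsLatentFamily) (hp : M.IsObsDensity p)
    (hexp : M.ExponentialAssumption 𝒮) (hreg : M.RegularityAssumption 𝒮 p)
    (hobs : M.ObservedRegularity p) {s : EuclideanSpace ℝ (Fin d)} (hs : s ∈ M.roots 𝒮 p) :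
    M.thetaBar s ∈ M.stationaryPoints p := by
  refine ⟨(thetaBar_spec hexp hs.1).1, ?_⟩
  have h := hasFDerivAt_kl_thetaBar hM hp hexp hreg hobs hs.1
    (integrable_condStat hM hp hexp hreg hs.1)
  rw [hs.2] at h
  rw [hasGradientAt_iff_hasFDerivAt, map_zero]
  simpa using h

/-- The centred E-step on a fixed compact set has bounded second moments. -/
theorem exists_lintegral_sq_sub_integral_le (hM : M.IsLatentFamily) (hp : M.IsObsDensity p)
    (hexp : M.ExponentialAssumption 𝒮) (hreg : M.RegularityAssumption 𝒮 p)
    {K : Set (EuclideanSpace ℝ (Fin d))} (hK : IsCompact K) (hK𝒮 : K ⊆ 𝒮) :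
    ∃ C : ℝ≥0∞, C ≠ ∞ ∧ ∀ s ∈ K, ∫⁻ y, ‖M.condStat y (M.thetaBar s) -
      ∫ y', M.condStat y' (M.thetaBar s) ∂(M.obsLaw p)‖ₑ ^ 2 ∂(M.obsLaw p) ≤ C := by
  have := isProbabilityMeasure_obsLaw hp
  obtain ⟨C, hC, hCK⟩ := exists_lintegral_sq_le hp hreg hK hK𝒮
  refine ⟨2 * C + 2 * (1 + C) ^ 2, by finiteness, fun s hs => ?_⟩
  have hint := integrable_condStat hM hp hexp hreg (hK𝒮 hs)
  set H := ∫ y', M.condStat y' (M.thetaBar s) ∂(M.obsLaw p) with hH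
  have hH1 : ‖H‖ₑ ≤ 1 + C := by
    refine (enorm_integral_le_lintegral_enorm _).trans ?_
    calc ∫⁻ y, ‖M.condStat y (M.thetaBar s)‖ₑ ∂(M.obsLaw p)
        ≤ ∫⁻ y, (1 + ‖M.condStat y (M.thetaBar s)‖ₑ ^ 2) ∂(M.obsLaw p) := by
          refine lintegral_mono fun y => ?_
          have h := le_min_add_sq_div ‖M.condStat y (M.thetaBar s)‖ₑ one_ne_zero ENNReal.one_ne_top
          rw [div_one] at h
          exact h.trans (by gcongr; exact min_le_right _ _)
      _ = 1 + ∫⁻ y, ‖M.condStat y (M.thetaBar s)‖ₑ ^ 2 ∂(M.obsLaw p) := by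
          rw [lintegral_add_left measurable_const, lintegral_one, measure_univ]
      _ ≤ 1 + C := by gcongr; exact hCK s hs
  calc ∫⁻ y, ‖M.condStat y (M.thetaBar s) - H‖ₑ ^ 2 ∂(M.obsLaw p)
      ≤ ∫⁻ y, (2 * ‖M.condStat y (M.thetaBar s)‖ₑ ^ 2 + 2 * ‖H‖ₑ ^ 2) ∂(M.obsLaw p) :=
        lintegral_mono fun y => enorm_sub_sq_le _ _
    _ = 2 * ∫⁻ y, ‖M.condStat y (M.thetaBar s)‖ₑ ^ 2 ∂(M.obsLaw p) + 2 * ‖H‖ₑ ^ 2 := by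
        rw [lintegral_add_right _ measurable_const, lintegral_const_mul' _ _ (by simp),
          lintegral_const, measure_univ, mul_one]
    _ ≤ 2 * C + 2 * (1 + C) ^ 2 := by gcongr; exact hCK s hs

/-- On the event that the statistics stay in a compact set, the weighted noise converges. -/
theorem ae_exists_tendsto_sum_noise (hM : M.IsLatentFamily) (hp : M.IsObsDensity p)
    (hexp : M.ExponentialAssumption 𝒮) (hreg : M.RegularityAssumption 𝒮 p)
    {K : Set (EuclideanSpace ℝ (Fin d))} (hK : IsCompact K) (hK𝒮 : K ⊆ 𝒮)
    {Ω : Type*} {m0 : MeasurableSpace Ω} {P : Measure Ω} [IsProbabilityMeasure P]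
    {ℱ : Filtration ℕ m0} {X : ℕ → Ω → EuclideanSpace ℝ (Fin d)} {Y : ℕ → Ω → 𝒴}
    (hX : ∀ n, Measurable[ℱ n] (X n)) (hY : ∀ n, Measurable[ℱ (n + 1)] (Y n))
    (hind : ∀ n, Indep (ℱ n) (MeasurableSpace.comap (Y n) inferInstance) P)
    (hlaw : ∀ n, P.map (Y n) = M.obsLaw p) {γ : ℕ → ℝ} (hγ : Summable fun n => γ n ^ 2) :
    ∀ᵐ ω ∂P, (∀ᶠ n in atTop, X n ω ∈ K) → ∃ l, Tendsto (fun n => ∑ k ∈ Finset.range n,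
      γ k • (M.condStat (Y k ω) (M.thetaBar (X k ω)) -
        ∫ y, M.condStat y (M.thetaBar (X k ω)) ∂(M.obsLaw p))) atTop (𝓝 l) := by
  have := isProbabilityMeasure_obsLaw hp
  obtain ⟨F, hF, hFeq⟩ := exists_stronglyMeasurable_condStat hM hexp hreg
  obtain ⟨C, hC, hCK⟩ := exists_lintegral_sq_sub_integral_le hM hp hexp hreg hK hK𝒮
  have hH : Measurable fun s => ∫ y, F (y, s) ∂(M.obsLaw p) :=
    (hF.comp_measurable measurable_swap).integral_prod_right'.measurable
  -- The cut-off outside `K` bounds the second moment uniformly in `s` and keeps the noise centred.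
  let G : EuclideanSpace ℝ (Fin d) × 𝒴 → EuclideanSpace ℝ (Fin d) :=
    (K ×ˢ Set.univ).indicator fun z => F (z.2, z.1) - ∫ y, F (y, z.1) ∂(M.obsLaw p)
  have hG : Measurable G :=
    ((hF.measurable.comp measurable_swap).sub (hH.comp measurable_fst)).indicator
      (hK.measurableSet.prod MeasurableSet.univ)
  have hGmem : ∀ s ∈ K, ∀ y, G (s, y) = M.condStat y (M.thetaBar s) -
      ∫ y, M.condStat y (M.thetaBar s) ∂(M.obsLaw p) := fun s hs y => by
    simp only [G]
    rw [Set.indicator_of_mem (show (s, y) ∈ K ×ˢ Set.univ from ⟨hs, trivial⟩)]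
    simp only [hFeq _ s (hK𝒮 hs)]
  have hGnot : ∀ s, s ∉ K → ∀ y, G (s, y) = 0 := fun s hs y =>
    Set.indicator_of_notMem (fun h => hs h.1) _
  have hzero : ∀ s, ∫ y, G (s, y) ∂(M.obsLaw p) = 0 := fun s => by
    by_cases hs : s ∈ K
    · simp only [hGmem s hs]
      rw [integral_sub (integrable_condStat hM hp hexp hreg (hK𝒮 hs)) (integrable_const _)]
      simp
    · simp [hGnot s hs]
  have hbound : ∀ s, ∫⁻ y, ‖G (s, y)‖ₑ ^ 2 ∂(M.obsLaw p) ≤ C := fun s => by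
    by_cases hs : s ∈ K
    · simp only [hGmem s hs]; exact hCK s hs
    · simp [hGnot s hs]
  have hGint : ∀ s, Integrable (fun y => G (s, y)) (M.obsLaw p) := fun s => by
    by_cases hs : s ∈ K
    · simp only [hGmem s hs]
      exact (integrable_condStat hM hp hexp hreg (hK𝒮 hs)).sub (integrable_const _)
    · simp [hGnot s hs]
  have hcoord : ∀ᵐ ω ∂P, ∀ i : Fin d, ∃ l, Tendsto (fun n => ∑ k ∈ Finset.range n,
      γ k * G (X k ω, Y k ω) i) atTop (𝓝 l) := by
    refine ae_all_iff.2 fun i => ?_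
    refine ae_exists_tendsto_sum_mul_comp hX hY hind hlaw (G := fun z => G z i)
      (by fun_prop) (fun s => ?_) hC (fun s => ?_) hγ
    · have h := (EuclideanSpace.proj (𝕜 := ℝ) i).integral_comp_comm (hGint s)
      rw [hzero, map_zero] at h
      exact h
    · refine (lintegral_mono fun y => ?_).trans (hbound s)
      gcongr
      exact enorm_le_iff_norm_le.2 (PiLp.norm_apply_le _ i)
  filter_upwards [hcoord] with ω hω hK
  choose l hl using hω
  obtain ⟨N, hN⟩ := eventually_atTop.1 hK
  have hGl : Tendsto (fun n => ∑ k ∈ Finset.range n, γ k • G (X k ω, Y k ω)) atTop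
      (𝓝 (WithLp.toLp 2 l)) := by
    have h := ((PiLp.continuous_toLp 2 fun _ : Fin d => ℝ).tendsto l).comp (tendsto_pi_nhds.2 hl)
    refine h.congr fun n => ?_
    ext i
    simp
  -- On a path that stays in `K` from time `N`, the cut-off changes only the terms before `N`.
  refine ⟨_, (hGl.add_const (∑ k ∈ Finset.range N, γ k •
    (M.condStat (Y k ω) (M.thetaBar (X k ω)) -
      ∫ y, M.condStat y (M.thetaBar (X k ω)) ∂(M.obsLaw p) - G (X k ω, Y k ω)))).congr' ?_⟩
  filter_upwards [eventually_ge_atTop N] with n hn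
  rw [← Finset.eventually_constant_sum (fun k hk => by
    rw [hGmem _ (hN k hk), sub_self, smul_zero]) hn, ← Finset.sum_add_distrib]
  refine Finset.sum_congr rfl fun k _ => ?_
  rw [← smul_add, add_sub_cancel]

theorem stat_mem (hexp : M.ExponentialAssumption 𝒮) {γ : ℕ → ℝ}
    (hγ : ∀ i, 1 ≤ i → 0 < γ i ∧ γ i < 1) (y : ℕ → 𝒴) {s₀ : EuclideanSpace ℝ (Fin d)}
    (hs₀ : s₀ ∈ 𝒮) (n : ℕ) : M.stat γ y s₀ n ∈ 𝒮 := by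
  induction n with
  | zero => exact hs₀
  | succ n ih =>
    have hγn := hγ (n + 1) (by omega)
    have h := hexp.stable _ ih (y (n + 1)) _ (thetaBar_spec hexp ih).1 _ hγn.1.le hγn.2
    rw [stat]
    convert h using 1
    module

/-- Almost surely the mean field vanishes along the statistics, which eventually stay in a
compact subset of `𝒮`. -/
theorem ae_tendsto_meanField_stat (hM : M.IsLatentFamily) (hp : M.IsObsDensity p)
    (hexp : M.ExponentialAssumption 𝒮) (hreg : M.RegularityAssumption 𝒮 p)
    (hobs : M.ObservedRegularity p)
    {Ω : Type*} [MeasurableSpace Ω] {P : Measure Ω} [IsProbabilityMeasure P]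
    {Y : ℕ → Ω → 𝒴} (hYm : ∀ i, 1 ≤ i → Measurable (Y i))
    (hYlaw : ∀ i, 1 ≤ i → P.map (Y i) = M.obsLaw p)
    (hYindep : iIndepFun (fun i : ℕ => Y (i + 1)) P)
    {s₀ : Ω → EuclideanSpace ℝ (Fin d)} (hs₀m : Measurable s₀)
    (hs₀indep : IndepFun s₀ (fun ω (i : ℕ) => Y (i + 1) ω) P)
    (hs₀ : ∀ᵐ ω ∂P, s₀ ω ∈ 𝒮)
    {γ : ℕ → ℝ} (hγ : ∀ i, 1 ≤ i → 0 < γ i ∧ γ i < 1)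
    (hγsum : Tendsto (fun n => ∑ i ∈ Finset.Icc 1 n, γ i) atTop atTop)
    (hγsq : Summable fun i : ℕ => γ (i + 1) ^ 2)
    (hbdd : ∀ᵐ ω ∂P,
      limsup (fun n => ‖M.stat γ (fun i => Y i ω) (s₀ ω) n‖ₑ) atTop < ⊤)
    (hdist : ∀ᵐ ω ∂P,
      0 < liminf (fun n => Metric.infEDist (M.stat γ (fun i => Y i ω) (s₀ ω) n) 𝒮ᶜ) atTop)
    (hw : IsNowhereDense (M.lyapunov p '' M.roots 𝒮 p)) :
    ∀ᵐ ω ∂P, ∃ K ⊆ 𝒮, IsCompact K ∧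
      (∀ᶠ n in atTop, M.stat γ (fun i => Y i ω) (s₀ ω) n ∈ K) ∧
      Tendsto (fun n => M.meanField p (M.stat γ (fun i => Y i ω) (s₀ ω) n)) atTop (𝓝 0) := by
  obtain ⟨F, hF, hFeq⟩ := exists_stronglyMeasurable_condStat hM hexp hreg
  -- The recursion is run with the jointly measurable `F`, hence adapted; it equals `stat` on paths
  -- starting in `𝒮`, which never leave `𝒮`.
  let X : ℕ → Ω → EuclideanSpace ℝ (Fin d) := fun n => Nat.rec s₀
    (fun n Xn ω => Xn ω + γ (n + 1) • (F (Y (n + 1) ω, Xn ω) - Xn ω)) n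
  have hXsucc : ∀ n ω, X (n + 1) ω = X n ω + γ (n + 1) • (F (Y (n + 1) ω, X n ω) - X n ω) :=
    fun _ _ => rfl
  have hY : ∀ n, Measurable (Y (n + 1)) := fun n => hYm _ (by omega)
  let ℱ := historyFiltration hs₀m hY
  have hYℱ : ∀ n, Measurable[ℱ (n + 1)] (Y (n + 1)) :=
    measurable_historyFiltration_obs hs₀m hY
  have hXℱ : ∀ n, Measurable[ℱ n] (X n) := fun n => by
    induction n with
    | zero => exact measurable_historyFiltration_init hs₀m hY 0
    | succ n ih =>
      have ih' : Measurable[ℱ (n + 1)] (X n) := ih.mono (ℱ.mono n.le_succ) le_rfl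
      change Measurable[ℱ (n + 1)]
        (X n + γ (n + 1) • ((F ∘ fun ω => (Y (n + 1) ω, X n ω)) - X n))
      exact ih'.add (((hF.measurable.comp ((hYℱ n).prodMk ih')).sub ih').const_smul _)
  have hnoise := ae_all_iff.2 fun k : ℕ => ae_exists_tendsto_sum_noise hM hp hexp hreg
    (isCompact_exhaustion 𝒮 k) (exhaustion_subset 𝒮 k) hXℱ hYℱ
    (indep_historyFiltration hs₀m hY hYindep hs₀indep) (fun n => hYlaw _ (by omega)) hγsq
  have hγ0 : Tendsto (fun n => γ (n + 1)) atTop (𝓝 0) := by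
    have h := hγsq.tendsto_atTop_zero.sqrt
    rw [Real.sqrt_zero] at h
    exact h.congr fun n => Real.sqrt_sq (hγ _ (by omega)).1.le
  have hsum : Tendsto (fun n => ∑ k ∈ Finset.range n, γ (k + 1)) atTop atTop := by
    refine hγsum.congr fun n => ?_
    induction n with
    | zero => simp
    | succ n ih => rw [Finset.sum_range_succ, ← ih, Finset.sum_Icc_succ_top (by omega)]
  filter_upwards [hs₀, hbdd, hdist, hnoise] with ω h0 hb hd hn
  have hmem := stat_mem hexp hγ (fun i => Y i ω) h0
  have hstat : ∀ n, X n ω = M.stat γ (fun i => Y i ω) (s₀ ω) n := fun n => by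
    induction n with
    | zero => rfl
    | succ n ih => rw [hXsucc, ih, hFeq _ _ (hmem n), stat]
  obtain ⟨k, hk⟩ := exists_eventually_mem_exhaustion hb hd
  refine ⟨_, exhaustion_subset 𝒮 k, isCompact_exhaustion 𝒮 k, hk, ?_⟩
  simp_rw [← hstat] at hk ⊢
  obtain ⟨l, hl⟩ := hn k hk
  refine tendsto_meanField_of_noise hM hp hexp hreg hobs hw (isCompact_exhaustion 𝒮 k)
    (exhaustion_subset 𝒮 k) (γ := fun n => γ (n + 1)) (fun n => hγ _ (by omega)) hγ0 hsum hk
    (fun n => ?_) hl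
  rw [hXsucc, hstat n, hFeq _ _ (hmem n), meanField]
  congr 2
  abel

end LatentModel

end OnlineEM

theorem mainTheorem1 {𝒳 𝒴 : Type*} [MeasurableSpace 𝒳] [MeasurableSpace 𝒴] {d m : ℕ}
    (M : OnlineEM.LatentModel 𝒳 𝒴 d m) (𝒮 : Set (EuclideanSpace ℝ (Fin d))) (p : 𝒴 → ℝ)
    (hM : M.IsLatentFamily) (hp : M.IsObsDensity p)
    (hexp : M.ExponentialAssumption 𝒮) (hreg : M.RegularityAssumption 𝒮 p)
    (hobs : M.ObservedRegularity p)
    {Ω : Type*} [MeasurableSpace Ω] (P : Measure Ω) [IsProbabilityMeasure P]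
    -- the observations `Y 1, Y 2, …` are i.i.d. with density `p`
    (Y : ℕ → Ω → 𝒴) (hYm : ∀ i, 1 ≤ i → Measurable (Y i))
    (hYlaw : ∀ i, 1 ≤ i → P.map (Y i) = M.obsLaw p)
    (hYindep : iIndepFun (fun i : ℕ => Y (i + 1)) P)
    -- the initial statistic, possibly random, is independent of the observations
    (s₀ : Ω → EuclideanSpace ℝ (Fin d)) (hs₀m : Measurable s₀)
    (hs₀indep : IndepFun s₀ (fun ω (i : ℕ) => Y (i + 1) ω) P)
    (hs₀ : ∀ᵐ ω ∂P, s₀ ω ∈ 𝒮)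
    -- the step sizes
    (γ : ℕ → ℝ) (hγ : ∀ i, 1 ≤ i → 0 < γ i ∧ γ i < 1)
    (hγsum : Tendsto (fun n => ∑ i ∈ Finset.Icc 1 n, γ i) atTop atTop)
    (hγsq : Summable fun i : ℕ => γ (i + 1) ^ 2)
    -- stability
    (hbdd : ∀ᵐ ω ∂P,
      limsup (fun n => ‖M.stat γ (fun i => Y i ω) (s₀ ω) n‖ₑ) atTop < ⊤)
    (hdist : ∀ᵐ ω ∂P,
      0 < liminf (fun n => Metric.infEDist (M.stat γ (fun i => Y i ω) (s₀ ω) n) 𝒮ᶜ) atTop)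
    (hw : IsNowhereDense (M.lyapunov p '' M.roots 𝒮 p)) :
    (∀ᵐ ω ∂P, Tendsto
      (fun n => Metric.infEDist (M.stat γ (fun i => Y i ω) (s₀ ω) n) (M.roots 𝒮 p))
      atTop (𝓝 0)) ∧
    (∀ᵐ ω ∂P, Tendsto
      (fun n => Metric.infEDist (M.param γ (fun i => Y i ω) (s₀ ω) n) (M.stationaryPoints p))
      atTop (𝓝 0)) := by
  have hmain := OnlineEM.LatentModel.ae_tendsto_meanField_stat hM hp hexp hreg hobs hYm hYlaw
    hYindep hs₀m hs₀indep hs₀ hγ hγsum hγsq hbdd hdist hw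
  have hh := OnlineEM.LatentModel.continuousOn_meanField hM hp hexp hreg hobs
  constructor
  · filter_upwards [hmain] with ω hω
    obtain ⟨K, hK𝒮, hK, hsK, hlim⟩ := hω
    exact OnlineEM.tendsto_infEDist_of_tendsto_zero hK (hh.mono hK𝒮) (τ := id) continuousOn_id
      (L := M.roots 𝒮 p) (fun s hs h0 => ⟨hK𝒮 hs, h0⟩) hsK hlim
  · filter_upwards [hmain] with ω hω
    -- The same compactness argument with τ = θ̄, which maps roots of the mean field to stationary
    -- points.
    obtain ⟨K, hK𝒮, hK, hsK, hlim⟩ := hω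
    exact OnlineEM.tendsto_infEDist_of_tendsto_zero hK (hh.mono hK𝒮)
      (hreg.contDiffOn_thetaBar.continuousOn.mono hK𝒮)
      (fun s hs h0 => OnlineEM.LatentModel.mem_stationaryPoints_of_mem_roots hM hp hexp hreg hobs
        ⟨hK𝒮 hs, h0⟩) hsK hlim
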